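/- A constraint of arity $k$ is a function $f:\{0,1\}^k\to\mathbb{R}^{\ge 0}$; its underlying relation is $R_f=\{x : f(x)\neq 0\}$. A binary constraint is written $(f(00),f(01),f(10),f(11))$; put $EQ=(1,0,0,1)$, $XOR=(0,1,1,0)$, $Implies=(1,1,0,1)$, and let $\mathcal{U}$ be the set of all unary constraints. Let $\mathcal{ED}$ be the set of all constraints that are finite products of unary constraints, $EQ$ and $XOR$, applied to the variables of the constraint. A constraint $f$ has affine support if $R_f$ is the solution set of a system of linear equations over $GF(2)$; it has imp support if $R_f$ is the conjunction of a positive number of relations of the forms $x_i=0$, $x_i=1$, and $Implies(x_i,x_j)$ with $i\neq j$. For a set $\mathcal{F}$ of constraints, $\mathrm{MAX\text{-}PROD\text{-}CSP}^*(\mathcal{F})$ is the following maximization problem. Instance: a number $n$ of Boolean variables and a finite list (repetitions allowed) of pairs $\langle h,(x_{i_1},\dots,x_{i_k})\rangle$ with $h\in\mathcal{F}\cup\mathcal{U}$ of arity $k$ and $i_1,\dots,i_k\in\{1,\dots,n\}$, not necessarily distinct. Solution: an assignment $\sigma\in\{0,1\}^n$. Measure: $\prod_{\langle h,(x_{i_1},\dots,x_{i_k})\rangle}h(\sigma(x_{i_1}),\dots,\sigma(x_{i_k}))$.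 Instances are words of real numbers ($n$ in unary, indices, and the table of the $2^k$ values of every listed constraint), and the size $|x|$ of an instance is the sum of the sizes of the entries of this word, where a real $r\ne0$ has size $1+|\log_2|r||$ and $0$ has size $1$. With $m^*(x)$ the maximum measure, a solution $y$ of $x$ is $\alpha$-approximate if $1/\alpha\le m(x,y)/m^*(x)\le\alpha$ when $m^*(x)\neq0$, and $m(x,y)=0$ when $m^*(x)=0$. A randomized approximation scheme for a problem outputs, on input $(x,\varepsilon)$ with $\varepsilon\in(0,1)$, a $2^{\varepsilon}$-approximate solution with probability at least $3/4$. A problem $P$ is APT-reducible to $Q$ if there are a randomized oracle algorithm $N$ (a finite program over real-number cells with unit-cost arithmetic, comparisons, coin tosses and oracle calls) and polynomials $p,q$ such that, for every randomized approximation scheme $M$ for $Q$ (of unrestricted complexity) used as oracle, each call being answered by a fresh random outcome of $M$: (i) $N$ is a randomized approximation scheme for $P$; (ii) on input $(x,\varepsilon)$ every oracle call has the form $(w,\delta)$ with $w$ an instance of $Q$, $\delta\in(0,1)$ and $1/\delta\le p(|x|,1/\varepsilon)$; (iii) on input $(x,\varepsilon)$, $N$ always halts within $q(|x|,1/\varepsilon)$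 steps. **Proposition.** Let $f$ be a constraint that has imp support. If $f$ does not have affine support or $f\notin\mathcal{ED}$, then, for every set $\mathcal{F}$ of constraints, $\mathrm{MAX\text{-}PROD\text{-}CSP}^*(\{Implies\}\cup\mathcal{F})$ is APT-reducible to $\mathrm{MAX\text{-}PROD\text{-}CSP}^*(\{f\}\cup\mathcal{F})$. -/

import Mathlib

open scoped NNReal ENNReal

noncomputable section

/-! ### Constraints -/

/-- A nonnegative-real-weighted Boolean constraint `{0,1}^k → ℝ≥0`; `false` is `0`, `true` is `1`. -/
structure Constraint where
  arity : ℕ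
  val : (Fin arity → Bool) → ℝ≥0

namespace Constraint

/-- The list of values in the lexicographic order of `{0,1}^k`
(the first coordinate is the most significant one). -/
def table : (k : ℕ) → ((Fin k → Bool) → ℝ≥0) → List ℝ≥0
  | 0, g => [g Fin.elim0]
  | k + 1, g =>
      table k (fun x => g (Fin.cons false x)) ++ table k (fun x => g (Fin.cons true x))

/-- `Implies = (1,1,0,1)`. -/
def implies : Constraint := ⟨2, fun x => if x 0 = true ∧ x 1 = false then 0 else 1⟩

/-- `EQ = (1,0,0,1)`. -/
def eq : Constraint := ⟨2, fun x => if x 0 = x 1 then 1 else 0⟩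

/-- `XOR = (0,1,1,0)`. -/
def xor : Constraint := ⟨2, fun x => if x 0 = x 1 then 0 else 1⟩

/-- The set `𝒰` of all unary constraints. -/
def unary : Set Constraint := {c | c.arity = 1}

/-- A constraint together with the variables, out of `x_0, …, x_{n-1}`, to which it is applied.
Variables may be repeated. -/
structure Applied (n : ℕ) where
  con : Constraint
  scope : Fin con.arity → Fin n

/-- The value of an applied constraint at an assignment of the variables. -/
def Applied.eval {n : ℕ} (a : Applied n) (σ : Fin n → Bool) : ℝ≥0 :=
  a.con.val (fun i => σ (a.scope i))

/-- The product of a finite collection of applied constraints at an assignment. -/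
def prodEval {n : ℕ} (H : List (Applied n)) (σ : Fin n → Bool) : ℝ≥0 :=
  (H.map (fun a => a.eval σ)).prod

/-- The set `ED` of all constraints that are products of unary constraints, `EQ` and `XOR`,
applied to the variables of the constraint. -/
def ED : Set Constraint :=
  {f | ∃ H : List (Applied f.arity),
    (∀ a ∈ H, a.con ∈ unary ∪ {eq, xor}) ∧ ∀ x, f.val x = prodEval H x}

/-- The underlying relation `R_f = {x | f x ≠ 0}`. -/
def support (f : Constraint) : Set (Fin f.arity → Bool) := {x | f.val x ≠ 0}

/-- A relation is affine if it is the solution set of a system of linear equations over `GF(2)`. -/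
def IsAffine {k : ℕ} (R : Set (Fin k → Bool)) : Prop :=
  ∃ (m : ℕ) (A : Matrix (Fin m) (Fin k) (ZMod 2)) (b : Fin m → ZMod 2),
    ∀ x, x ∈ R ↔ A.mulVec (fun i => if x i = true then 1 else 0) = b

def HasAffineSupport (f : Constraint) : Prop := IsAffine f.support

/-- The atomic relations `Δ₀(x_i)`, `Δ₁(x_i)` and `Implies(x_i, x_j)` (with `x_i`, `x_j` distinct
variables) on `k` variables. -/
inductive ImpAtom (k : ℕ) where
  | delta0 (i : Fin k)
  | delta1 (i : Fin k)
  | imp (i j : Fin k) (h : i ≠ j)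

def ImpAtom.Holds {k : ℕ} (x : Fin k → Bool) : ImpAtom k → Prop
  | .delta0 i => x i = false
  | .delta1 i => x i = true
  | .imp i j _ => x i = true → x j = true

/-- `R_f` is a conjunction of a positive number of relations `Δ₀(x)`, `Δ₁(x)`, `Implies(x,y)`. -/
def HasImpSupport (f : Constraint) : Prop :=
  ∃ L : List (ImpAtom f.arity), L ≠ [] ∧ ∀ x, x ∈ f.support ↔ ∀ a ∈ L, a.Holds x

end Constraint

/-! ### Optimization problems and approximate solutions -/

/-- A maximization problem. Instances and solutions are presented to machines as words over `ℝ`. -/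
structure MaxProblem where
  Inst : Type
  Sol : Inst → Type
  measure : (x : Inst) → Sol x → ℝ≥0
  encInst : Inst → List ℝ
  encSol : (x : Inst) → Sol x → List ℝ

/-- The size of a word over `ℝ`: the sum of the sizes of its entries, the entry `r` having the size
`1 + |log₂ |r||`, and the entry `0` the size `1`. -/
def wordSize (w : List ℝ) : ℝ := (w.map (fun r => 1 + |Real.logb 2 (|r|)|)).sum

namespace MaxProblem

/-- The size `|x|` of an instance. -/
def size (P : MaxProblem) (x : P.Inst) : ℝ := wordSize (P.encInst x)

/-- `y` is an `α`-approximate solution: `1/α ≤ m(x,y)/m*(x) ≤ α`, where `m*(x)` is the optimum;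
if `m*(x) = 0` then it is required that `m(x,y) = 0`. -/
def IsApproxSol (P : MaxProblem) (x : P.Inst) (α : ℝ) (y : P.Sol x) : Prop :=
  ∃ opt : ℝ≥0, IsGreatest (Set.range (P.measure x)) opt ∧
    (opt = 0 → P.measure x y = 0) ∧
    (opt ≠ 0 → 1 / α ≤ (P.measure x y : ℝ) / opt ∧ (P.measure x y : ℝ) / opt ≤ α)

/-- The outputs that encode `2^ε`-approximate solutions of `x`. -/
def goodOutputs (P : MaxProblem) (x : P.Inst) (ε : ℝ) : Set (List ℝ) :=
  {o | ∃ y : P.Sol x, o = P.encSol x y ∧ P.IsApproxSol x ((2 : ℝ) ^ ε) y}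

end MaxProblem

/-- The behaviour of a (not necessarily resource-bounded) randomized algorithm on words over `ℝ`:
the distribution of its output on each input. -/
abbrev Oracle := List ℝ → PMF (List ℝ)

/-- `M` is a randomized approximation scheme for `P`. The input `(x, ε)` is the word that starts
with `ε` and goes on with the encoding of `x`. -/
def IsRandomizedApproxScheme (P : MaxProblem) (M : Oracle) : Prop :=
  ∀ (x : P.Inst) (ε : ℝ), 0 < ε → ε < 1 →
    (3 / 4 : ℝ≥0∞) ≤ (M (ε :: P.encInst x)).toOuterMeasure (P.goodOutputs x ε)

/-! ### Randomized oracle machines over the reals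

A machine is a finite program that works on stacks of real numbers, with unit-cost arithmetic and
comparisons, fair coin tosses and oracle calls. Only the finitely many stacks that are named in the
program can be accessed by it. -/

/-- Arithmetic operations (with `r / 0 = 0`). -/
inductive ArithOp where
  | add
  | sub
  | mul
  | div

def ArithOp.apply : ArithOp → ℝ → ℝ → ℝ
  | .add, a, b => a + b
  | .sub, a, b => a - b
  | .mul, a, b => a * b
  | .div, a, b => a / b

/-- The contents of the stacks; the head of a list is the top of the stack. -/
abbrev Memory := ℕ → List ℝ

/-- The top of the stack `s`, read as `0` if the stack is empty. -/
def Memory.top (μ : Memory) (s : ℕ) : ℝ := (μ s).headD 0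

def Memory.push (μ : Memory) (s : ℕ) (r : ℝ) : Memory := Function.update μ s (r :: μ s)

/-- Tests: whether stack `s` is non-empty; whether the top of `s` is at most the top of `t`. -/
inductive Test where
  | nonempty (s : ℕ)
  | le (s t : ℕ)

def Test.Holds (μ : Memory) : Test → Prop
  | .nonempty s => μ s ≠ []
  | .le s t => μ.top s ≤ μ.top t

/-- Programs. -/
inductive Prog where
  /-- do nothing -/
  | skip
  /-- push the constant `r` on stack `s` -/
  | const (s : ℕ) (r : ℝ)
  /-- remove the top of stack `s` -/
  | pop (s : ℕ)
  /-- push the top of stack `s` on stack `t` -/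
  | copy (s t : ℕ)
  /-- apply `op` to the tops of stacks `s` and `t` and push the result on stack `u` -/
  | arith (op : ArithOp) (s t u : ℕ)
  /-- push a fair random bit on stack `s` -/
  | flip (s : ℕ)
  /-- call the oracle on the word on stack `q`, erase that word, and put the answer on stack `a` -/
  | call (q a : ℕ)
  | seq (c d : Prog)
  | cond (b : Test) (c d : Prog)
  | loop (b : Test) (c : Prog)

/-- A configuration: the programs still to be executed, in this order, and the memory. -/
structure Config where
  code : List Prog
  mem : Memory

namespace Config

open scoped Classical in
/-- One step of the computation with oracle `M`. Every call of the oracle and every coin toss uses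
fresh randomness. A configuration without remaining code has halted and does not change. -/
def step (M : Oracle) : Config → PMF Config
  | ⟨[], μ⟩ => PMF.pure ⟨[], μ⟩
  | ⟨.skip :: k, μ⟩ => PMF.pure ⟨k, μ⟩
  | ⟨.const s r :: k, μ⟩ => PMF.pure ⟨k, μ.push s r⟩
  | ⟨.pop s :: k, μ⟩ => PMF.pure ⟨k, Function.update μ s (μ s).tail⟩
  | ⟨.copy s t :: k, μ⟩ => PMF.pure ⟨k, μ.push t (μ.top s)⟩
  | ⟨.arith op s t u :: k, μ⟩ => PMF.pure ⟨k, μ.push u (op.apply (μ.top s) (μ.top t))⟩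
  | ⟨.flip s :: k, μ⟩ =>
      (PMF.uniformOfFintype Bool).map (fun b => ⟨k, μ.push s (if b then 1 else 0)⟩)
  | ⟨.call q a :: k, μ⟩ =>
      (M (μ q)).map (fun w => ⟨k, Function.update (Function.update μ q []) a w⟩)
  | ⟨.seq c d :: k, μ⟩ => PMF.pure ⟨c :: d :: k, μ⟩
  | ⟨.cond b c d :: k, μ⟩ => PMF.pure (if b.Holds μ then ⟨c :: k, μ⟩ else ⟨d :: k, μ⟩)
  | ⟨.loop b c :: k, μ⟩ => PMF.pure (if b.Holds μ then ⟨c :: .loop b c :: k, μ⟩ else ⟨k, μ⟩)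

/-- The distribution of the configuration after `t` steps. -/
def run (M : Oracle) : ℕ → Config → PMF Config
  | 0, C => PMF.pure C
  | t + 1, C => (step M C).bind (run M t)

/-- The initial configuration: the input word is on stack `0`, all other stacks are empty. -/
def start (N : Prog) (input : List ℝ) : Config :=
  ⟨[N], Function.update (fun _ => []) 0 input⟩

def Halted (C : Config) : Prop := C.code = []

/-- The output is the content of stack `1`. -/
def output (C : Config) : List ℝ := C.mem 1

/-- The next step of `C` is an oracle call on the word `w`. -/
def Calls (C : Config) (w : List ℝ) : Prop :=
  ∃ q a k, C.code = Prog.call q a :: k ∧ C.mem q = w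

end Config

/-- Polynomial-time randomized approximation-preserving Turing reducibility from `P` to `Q`. The
program and the polynomials `p`, `q` depend on neither the oracle nor the input. -/
def APTReduces (P Q : MaxProblem) : Prop :=
  ∃ (N : Prog) (p q : MvPolynomial (Fin 2) ℝ),
    ∀ M : Oracle, IsRandomizedApproxScheme Q M →
    ∀ (x : P.Inst) (ε : ℝ), 0 < ε → ε < 1 →
      -- every oracle call is of the form `(w, δ)` with `w` an instance of `Q`, `0 < δ < 1` and
      -- `1 / δ ≤ p(|x|, 1/ε)`
      (∀ (t : ℕ), ∀ C ∈ (Config.run M t (Config.start N (ε :: P.encInst x))).support,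
        ∀ w, C.Calls w → ∃ (v : Q.Inst) (δ : ℝ), w = δ :: Q.encInst v ∧ 0 < δ ∧ δ < 1 ∧
          1 / δ ≤ MvPolynomial.eval ![P.size x, 1 / ε] p) ∧
      -- within `q(|x|, 1/ε)` steps the machine halts on every computation path, and its output
      -- is a `2^ε`-approximate solution with probability at least `3/4`
      ∃ T : ℕ, (T : ℝ) ≤ MvPolynomial.eval ![P.size x, 1 / ε] q ∧
        (∀ C ∈ (Config.run M T (Config.start N (ε :: P.encInst x))).support, C.Halted) ∧
        (3 / 4 : ℝ≥0∞) ≤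
          ((Config.run M T (Config.start N (ε :: P.encInst x))).map Config.output).toOuterMeasure
            (P.goodOutputs x ε)

/-! ### The problems MAX-PROD-CSP -/

/-- Self-delimiting encoding of a list of words: every word is preceded by `1`, and `0` marks
the end. -/
def encList : List (List ℝ) → List ℝ
  | [] => [0]
  | w :: l => 1 :: (w ++ encList l)

/-- A bit as a real number. -/
def encBit (b : Bool) : ℝ := if b then 1 else 0

/-- An applied constraint is written as the list of the indices of its variables, followed by the
list of its values. -/
def Constraint.Applied.enc {n : ℕ} (a : Constraint.Applied n) : List ℝ :=
  encList (List.ofFn (fun i => [((a.scope i : ℕ) : ℝ)])) ++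
    encList ((Constraint.table a.con.arity a.con.val).map (fun r => [(r : ℝ)]))

/-- An instance of MAX-PROD-CSP(`F`): a number `n` of Boolean variables and finitely many
constraints from `F` applied to these variables. -/
structure CSPInstance (F : Set Constraint) where
  n : ℕ
  cons : List (Constraint.Applied n)
  mem : ∀ a ∈ cons, a.con ∈ F

/-- The number `n` of variables is written in unary, and is followed by the list of constraints. -/
def CSPInstance.enc {F : Set Constraint} (x : CSPInstance F) : List ℝ :=
  encList (List.replicate x.n []) ++ encList (x.cons.map Constraint.Applied.enc)

/-- MAX-PROD-CSP(`F`): the solutions are the truth assignments to the variables, and the measure is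
the product of the values of the constraints. -/
def MaxProdCSP (F : Set Constraint) : MaxProblem where
  Inst := CSPInstance F
  Sol x := Fin x.n → Bool
  measure x σ := Constraint.prodEval x.cons σ
  encInst := CSPInstance.enc
  encSol _ σ := List.ofFn (fun i => encBit (σ i))

/-- MAX-PROD-CSP*(`F`): all unary constraints may be used in addition. -/
def MaxProdCSPStar (F : Set Constraint) : MaxProblem := MaxProdCSP (F ∪ Constraint.unary)

end

/-!
A function in `ED` has affine support, so in either case `f ∉ ED`. Imp support makes the support of
`f` a distributive lattice. If `f` were modular on it and the lattice were closed under relative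
complements, then it would be a Boolean cube, and `f` would be the product of its values at the
atoms, hence in `ED`. So there are `v`, `w` such that `f (v ⊓ w)`, `f v`, `f (v ⊔ w)` are nonzero
and `f v * f w ≠ f (v ⊓ w) * f (v ⊔ w)`. After rescaling by unary constraints, the binary function
given by the four values is `1` at three points and `δ ≠ 1` at the fourth, and a few such functions
with `δ < 1` combine to a gadget for `Implies` that is at most `1 / 2` at `(1, 0)` and `1`
elsewhere, for the best choice of its auxiliary variables.

The reduction replaces every `Implies` by `m` copies of the gadget, with new auxiliary variables. If
all measures, and the inverses of the nonzero ones, are at most `B`, and `(2 * B) ^ 2 < 2 ^ m`, then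
an approximate solution of the new instance cannot afford to violate an `Implies`, unless all
measures are `0`, and its restriction is an equally good solution of the given instance. Taking for
`B` the product of all `max r r⁻¹` over the positive numbers `r` in the input makes `m` linear in
the size of the instance, so that one oracle call after polynomially many steps suffices.
-/

/-! ### Constraints with imp support -/

namespace Constraint

section EdFunctions

variable {k : ℕ}

theorem prodEval_append (H H' : List (Applied k)) (x : Fin k → Bool) :
    prodEval (H ++ H') x = prodEval H x * prodEval H' x := by
  simp [prodEval]

/-- The products of unary constraints, `EQ` and `XOR` on `k` variables, as a multiplicative
submonoid of all functions: `f ∈ ED` unfolds to `f.val ∈ edFunctions f.arity`. -/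
def edFunctions (k : ℕ) : Submonoid ((Fin k → Bool) → ℝ≥0) where
  carrier := {g | ∃ H : List (Applied k),
    (∀ a ∈ H, a.con ∈ unary ∪ {eq, xor}) ∧ ∀ x, g x = prodEval H x}
  one_mem' := ⟨[], by simp, fun _ => rfl⟩
  mul_mem' := by
    rintro g g' ⟨H, hH, hg⟩ ⟨H', hH', hg'⟩
    refine ⟨H ++ H', fun a ha => (List.mem_append.1 ha).elim (hH a) (hH' a), fun x => ?_⟩
    rw [prodEval_append, Pi.mul_apply, hg, hg']

theorem mem_ED_iff {f : Constraint} : f ∈ ED ↔ f.val ∈ edFunctions f.arity := Iff.rfl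

theorem eval_mem_edFunctions {a : Applied k} (ha : a.con ∈ unary ∪ {eq, xor}) :
    a.eval ∈ edFunctions k :=
  ⟨[a], by simpa using ha, fun _ => (mul_one _).symm⟩

theorem comp_eval_mem_edFunctions (i : Fin k) (g : Bool → ℝ≥0) :
    (fun x => g (x i)) ∈ edFunctions k :=
  eval_mem_edFunctions (a := ⟨⟨1, fun x => g (x 0)⟩, fun _ => i⟩) (Or.inl rfl)

theorem ite_eq_mem_edFunctions (i j : Fin k) :
    (fun x => if x i = x j then 1 else 0) ∈ edFunctions k :=
  eval_mem_edFunctions (a := ⟨eq, ![i, j]⟩) (Or.inr (Or.inl rfl))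

theorem prod_mem_edFunctions {ι : Type*} (s : Finset ι) {g : ι → (Fin k → Bool) → ℝ≥0}
    (hg : ∀ i, g i ∈ edFunctions k) : (fun x => ∏ i ∈ s, g i x) ∈ edFunctions k := by
  rw [← Finset.prod_fn]
  exact Submonoid.prod_mem _ fun i _ => hg i

theorem exists_equation_of_unary (i : Fin k) (g : Bool → ℝ≥0) :
    ∃ (r : Fin k → ZMod 2) (b : ZMod 2), ∀ x : Fin k → Bool,
      g (x i) ≠ 0 ↔ r ⬝ᵥ (fun j => if x j = true then 1 else 0) = b := by
  by_cases h₀ : g false = 0 <;> by_cases h₁ : g true = 0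
  · exact ⟨0, 1, fun x => by cases h : x i <;> simp [h₀, h₁]⟩
  · exact ⟨Pi.single i 1, 1, fun x => by cases h : x i <;> simp [h, h₀, h₁]⟩
  · exact ⟨Pi.single i 1, 0, fun x => by cases h : x i <;> simp [h, h₀, h₁]⟩
  · exact ⟨0, 0, fun x => by cases h : x i <;> simp [h₀, h₁]⟩

theorem exists_equation_of_eval_ne_zero {a : Applied k} (ha : a.con ∈ unary ∪ {eq, xor}) :
    ∃ (r : Fin k → ZMod 2) (b : ZMod 2), ∀ x : Fin k → Bool,
      a.eval x ≠ 0 ↔ r ⬝ᵥ (fun j => if x j = true then 1 else 0) = b := by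
  obtain ⟨c, s⟩ := a
  obtain hc | rfl | rfl := ha
  · obtain ⟨_, g⟩ := c
    obtain rfl : _ = 1 := hc
    change Fin 1 → Fin k at s
    obtain ⟨r, b, h⟩ := exists_equation_of_unary (s 0) (fun t => g fun _ => t)
    have hs : s = fun _ => s 0 := funext fun i => congrArg s (Subsingleton.elim i 0)
    refine ⟨r, b, fun x => ?_⟩
    rw [← h, hs]
    rfl
  · change Fin 2 → Fin k at s
    refine ⟨Pi.single (s 0) 1 - Pi.single (s 1) 1, 0, fun x => ?_⟩
    cases h₀ : x (s 0) <;> cases h₁ : x (s 1) <;> simp [Applied.eval, eq, h₀, h₁]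
  · change Fin 2 → Fin k at s
    refine ⟨Pi.single (s 0) 1 - Pi.single (s 1) 1, 1, fun x => ?_⟩
    cases h₀ : x (s 0) <;> cases h₁ : x (s 1) <;> simp [Applied.eval, xor, h₀, h₁]

theorem hasAffineSupport_of_mem_ED {f : Constraint} (hf : f ∈ ED) : f.HasAffineSupport := by
  obtain ⟨H, hH, hf⟩ := hf
  choose A b hAb using fun t : Fin H.length =>
    exists_equation_of_eval_ne_zero (hH H[t] (List.getElem_mem _))
  refine ⟨H.length, A, b, fun x => ?_⟩
  rw [funext_iff]
  refine Iff.trans ?_ (forall_congr' fun t => hAb t x)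
  simp [support, hf, prodEval, List.prod_eq_zero_iff, List.mem_iff_getElem, Fin.forall_iff]

end EdFunctions

section Subcube

variable {k : ℕ} {R : Set (Fin k → Bool)} {l u : Fin k → Bool}

/-- Two coordinates are related if they agree on all elements of `R`. -/
def agree (R : Set (Fin k → Bool)) : Setoid (Fin k) where
  r i j := ∀ y ∈ R, y i = y j
  iseqv := ⟨fun _ _ _ => rfl, fun h y hy => (h y hy).symm,
    fun h h' y hy => (h y hy).trans (h' y hy)⟩

/-- `R` is a Boolean cube with bottom `l` and top `u` whose atoms are the classes of `agree R`:
it is defined by fixing coordinates and by identifying coordinates. -/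
structure IsSubcube (R : Set (Fin k → Bool)) (l u : Fin k → Bool) : Prop where
  bot_mem : l ∈ R
  top_mem : u ∈ R
  mem_iff : ∀ x, x ∈ R ↔ l ≤ x ∧ x ≤ u ∧ ∀ i j, agree R i j → x i = x j

theorem IsSubcube.indicator_mem_edFunctions (h : IsSubcube R l u) :
    R.indicator 1 ∈ edFunctions k := by
  classical
  have hR : R.indicator 1 =
      (fun x => ∏ i, if l i ≤ x i then (1 : ℝ≥0) else 0) *
      ((fun x => ∏ i, if x i ≤ u i then 1 else 0) *
      fun x => ∏ p : Fin k × Fin k with agree R p.1 p.2, if x p.1 = x p.2 then 1 else 0) := by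
    funext x
    simp only [Set.indicator_apply, Pi.one_apply, Pi.mul_apply, Finset.prod_ite_zero,
      Finset.prod_const_one, ite_zero_mul_ite_zero, mul_one]
    refine if_congr ((h.mem_iff x).trans ?_) rfl rfl
    simp [Pi.le_def]
  rw [hR]
  exact mul_mem
    (prod_mem_edFunctions _ fun i => comp_eval_mem_edFunctions i fun b => if l i ≤ b then 1 else 0)
    (mul_mem
      (prod_mem_edFunctions _ fun i =>
        comp_eval_mem_edFunctions i fun b => if b ≤ u i then 1 else 0)
      (prod_mem_edFunctions _ fun p => ite_eq_mem_edFunctions p.1 p.2))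

open scoped Classical in
/-- The indicator function of the class of `i` under `agree R`. -/
noncomputable def block (R : Set (Fin k → Bool)) (i : Fin k) : Fin k → Bool :=
  fun j => decide (agree R i j)

theorem block_eq_true_iff {i j : Fin k} : block R i j = true ↔ agree R i j := by
  simp [block]

theorem IsSubcube.sup_block_mem (h : IsSubcube R l u) {i : Fin k} (hi : u i = true) :
    l ⊔ block R i ∈ R := by
  refine (h.mem_iff _).2 ⟨le_sup_left, sup_le ((h.mem_iff u).1 h.top_mem).1 fun j => ?_,
    fun j j' hjj' => ?_⟩
  · refine Bool.le_iff_imp.2 fun hj => ?_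
    rw [← block_eq_true_iff.1 hj u h.top_mem, hi]
  · have hblock : block R i j = block R i j' := Bool.eq_iff_iff.2 <| by
      simp only [block_eq_true_iff]
      exact ⟨fun hj => (agree R).trans hj hjj', fun hj => (agree R).trans hj ((agree R).symm hjj')⟩
    rw [Pi.sup_apply, Pi.sup_apply, hblock, hjj' l h.bot_mem]

/-- A set of representatives of the classes of `agree R` on which `l` vanishes. -/
noncomputable def representatives (R : Set (Fin k → Bool)) (l : Fin k → Bool) : Finset (Fin k) :=
  {i | l i = false ∧ (Quotient.mk (agree R) i).out = i}

theorem disjoint_block {i j : Fin k} (hi : i ∈ representatives R l) (hj : j ∈ representatives R l)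
    (hij : i ≠ j) : block R i ⊓ block R j = ⊥ := by
  funext t
  by_contra ht
  obtain ⟨hit, hjt⟩ : agree R i t ∧ agree R j t := by
    simpa [block_eq_true_iff] using ht
  have hclass : Quotient.mk (agree R) i = Quotient.mk (agree R) j :=
    Quotient.sound ((agree R).trans hit ((agree R).symm hjt))
  simp only [representatives, Finset.mem_filter] at hi hj
  exact hij (hi.2.2.symm.trans ((congrArg Quotient.out hclass).trans hj.2.2))

theorem IsSubcube.eq_sup_blocks (h : IsSubcube R l u) {x : Fin k → Bool} (hx : x ∈ R) :
    l ⊔ {i ∈ representatives R l | x i = true}.sup (fun i => l ⊔ block R i) = x := by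
  have hlx : l ≤ x := ((h.mem_iff x).1 hx).1
  refine le_antisymm (sup_le hlx (Finset.sup_le fun i hi => sup_le hlx fun j => ?_)) fun j => ?_
  · refine Bool.le_iff_imp.2 fun hj => ?_
    rw [← block_eq_true_iff.1 hj x hx, (Finset.mem_filter.1 hi).2]
  · refine Bool.le_iff_imp.2 fun hj => ?_
    cases hlj : l j with
    | true => simp [hlj]
    | false =>
      set r := (Quotient.mk (agree R) j).out with hr
      have hrj : agree R r j := Quotient.mk_out j
      have hr_mem : r ∈ ({i ∈ representatives R l | x i = true} : Finset (Fin k)) := by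
        simp only [representatives, Finset.mem_filter, Finset.mem_univ, true_and, hrj x hx, hj,
          hrj l h.bot_mem, hlj, and_true]
        rw [hr, Quotient.out_eq]
      have hle : block R r ≤
          l ⊔ {i ∈ representatives R l | x i = true}.sup fun i => l ⊔ block R i :=
        le_sup_right.trans ((Finset.le_sup (f := fun i => l ⊔ block R i) hr_mem).trans le_sup_right)
      exact Bool.le_iff_imp.1 (hle j) (block_eq_true_iff.2 hrj)

end Subcube

section Modular

theorem map_sup_eq_mul_prod {α ι K : Type*} [DistribLattice α] [OrderBot α]
    [CommGroupWithZero K] {R : Set α} {g : α → K} (hR : SupClosed R)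
    (hg : ∀ x ∈ R, ∀ y ∈ R, g x * g y = g (x ⊓ y) * g (x ⊔ y)) {l : α} (hl : l ∈ R)
    (hgl : g l ≠ 0) {T : Finset ι} {e : ι → α} (he : ∀ i ∈ T, e i ∈ R) (hle : ∀ i ∈ T, l ≤ e i)
    (hdisj : (T : Set ι).Pairwise fun i j => e i ⊓ e j = l) :
    l ⊔ T.sup e ∈ R ∧ g (l ⊔ T.sup e) = g l * ∏ i ∈ T, g (e i) / g l := by
  classical
  induction T using Finset.induction_on with
  | empty => simpa using hl
  | insert a T haT ih =>
    rw [Finset.forall_mem_insert] at he hle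
    obtain ⟨hmem, hprod⟩ := ih he.2 hle.2
      (hdisj.mono (Finset.coe_subset.2 (Finset.subset_insert a T)))
    have hinf : e a ⊓ (l ⊔ T.sup e) = l := by
      rw [inf_sup_left, inf_eq_right.2 hle.1, Finset.sup_inf_distrib_left, sup_eq_left]
      exact Finset.sup_le fun i hi => (hdisj (Finset.mem_insert_self a T)
        (Finset.mem_insert_of_mem hi) (ne_of_mem_of_not_mem hi haT).symm).le
    have hsup : l ⊔ (insert a T).sup e = e a ⊔ (l ⊔ T.sup e) := by
      rw [Finset.sup_insert, sup_left_comm]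
    have hmod := hg _ he.1 _ hmem
    rw [hinf, ← hsup, hprod] at hmod
    refine ⟨hsup ▸ hR he.1 hmem, mul_left_cancel₀ hgl (hmod.symm.trans ?_)⟩
    rw [Finset.prod_insert haT]
    field_simp

variable {k : ℕ} {l u : Fin k → Bool}

theorem IsSubcube.mem_edFunctions {g : (Fin k → Bool) → ℝ≥0}
    (h : IsSubcube (Function.support g) l u) (hR : SupClosed (Function.support g))
    (hg : ∀ x ∈ Function.support g, ∀ y ∈ Function.support g,
      g x * g y = g (x ⊓ y) * g (x ⊔ y)) (i₀ : Fin k) : g ∈ edFunctions k := by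
  set R := Function.support g
  have hprod {x} (hx : x ∈ R) :
      g x = g l * ∏ i ∈ representatives R l, if x i = true then g (l ⊔ block R i) / g l else 1 := by
    rw [← Finset.prod_filter]
    conv_lhs => rw [← h.eq_sup_blocks hx]
    refine (map_sup_eq_mul_prod hR hg h.bot_mem h.bot_mem (fun i hi => h.sup_block_mem ?_)
      (fun _ _ => le_sup_left) fun i hi j hj hij => ?_).2
    · exact Bool.le_iff_imp.1 (((h.mem_iff x).1 hx).2.1 i) (Finset.mem_filter.1 hi).2
    · change (l ⊔ block R i) ⊓ (l ⊔ block R j) = l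
      rw [← sup_inf_left, disjoint_block (Finset.mem_filter.1 hi).1 (Finset.mem_filter.1 hj).1 hij,
        sup_bot_eq]
  have hfactor : g = R.indicator 1 * ((fun _ => g l) * fun x =>
      ∏ i ∈ representatives R l, if x i = true then g (l ⊔ block R i) / g l else 1) := by
    funext x
    by_cases hx : x ∈ R
    · simp [hx, hprod hx]
    · simp [hx, Function.notMem_support.1 hx]
  rw [hfactor]
  exact mul_mem h.indicator_mem_edFunctions (mul_mem (comp_eval_mem_edFunctions i₀ fun _ => g l)
    (prod_mem_edFunctions _ fun i =>
      comp_eval_mem_edFunctions i fun b => if b = true then g (l ⊔ block R i) / g l else 1))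

end Modular

section ImpSupport

variable {k : ℕ}

theorem ImpAtom.Holds.sup {a : ImpAtom k} {x y : Fin k → Bool} (hx : a.Holds x) (hy : a.Holds y) :
    a.Holds (x ⊔ y) := by
  cases a <;>
    simp_all only [ImpAtom.Holds, Pi.sup_apply, Bool.sup_eq_bor, Bool.or_eq_true, Bool.or_false,
      Bool.or_true]
  tauto

theorem ImpAtom.Holds.inf {a : ImpAtom k} {x y : Fin k → Bool} (hx : a.Holds x) (hy : a.Holds y) :
    a.Holds (x ⊓ y) := by
  cases a <;> simp_all [ImpAtom.Holds]

theorem ImpAtom.holds_of_agree {a : ImpAtom k} {R : Set (Fin k → Bool)} {l u x : Fin k → Bool}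
    (ha : ∀ y ∈ R, a.Holds y) (hl : l ∈ R) (hu : u ∈ R) (hR : ∀ y ∈ R, l ⊔ (u ⊓ yᶜ) ∈ R)
    (hlx : l ≤ x) (hxu : x ≤ u) (hx : ∀ i j, agree R i j → x i = x j) : a.Holds x := by
  cases a with
  | delta0 i => exact Bool.eq_false_of_le_false ((hxu i).trans_eq (ha u hu))
  | delta1 i => exact Bool.eq_true_of_true_le ((ha l hl).symm.trans_le (hlx i))
  | imp i j hij =>
    intro hxi
    by_cases hagree : agree R i j
    · rwa [← hx i j hagree]
    -- Some `y ∈ R` separates `i` from `j`; its relative complement forces `u i → l j`.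
    obtain ⟨y, hy, hyij⟩ : ∃ y ∈ R, y i ≠ y j := by
      by_contra! h
      exact hagree h
    have hyi : y i = false ∧ y j = true := by
      have := ha y hy
      cases hi : y i <;> cases hj : y j <;> simp_all [ImpAtom.Holds]
    have himp := ha _ (hR y hy)
    have hui : u i = true := Bool.le_iff_imp.1 (hxu i) hxi
    exact Bool.le_iff_imp.1 (hlx j) (by simpa [ImpAtom.Holds, hyi, hui] using himp)

variable {f : Constraint}

theorem HasImpSupport.supClosed (hf : f.HasImpSupport) : SupClosed f.support := by
  obtain ⟨L, -, hL⟩ := hf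
  intro x hx y hy
  rw [hL] at hx hy ⊢
  exact fun a ha => (hx a ha).sup (hy a ha)

theorem HasImpSupport.infClosed (hf : f.HasImpSupport) : InfClosed f.support := by
  obtain ⟨L, -, hL⟩ := hf
  intro x hx y hy
  rw [hL] at hx hy ⊢
  exact fun a ha => (hx a ha).inf (hy a ha)

theorem HasImpSupport.nonempty_fin (hf : f.HasImpSupport) : Nonempty (Fin f.arity) := by
  obtain ⟨_ | ⟨⟨i⟩ | ⟨i⟩ | ⟨i⟩, _⟩, hL, -⟩ := hf
  · exact absurd rfl hL
  all_goals exact ⟨i⟩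

theorem HasImpSupport.exists_isSubcube (hf : f.HasImpSupport) (hne : f.support.Nonempty)
    (hcompl : ∀ l ∈ f.support, ∀ u ∈ f.support, ∀ y ∈ f.support, l ≤ y → y ≤ u →
      l ⊔ (u ⊓ yᶜ) ∈ f.support) :
    ∃ l u, IsSubcube f.support l u := by
  have hl := hf.infClosed.sInf_mem_of_nonempty (Set.toFinite _) hne subset_rfl
  have hu := hf.supClosed.sSup_mem_of_nonempty (Set.toFinite _) hne subset_rfl
  have hle : ∀ y ∈ f.support, sInf f.support ≤ y := fun y hy => sInf_le hy
  have hge : ∀ y ∈ f.support, y ≤ sSup f.support := fun y hy => le_sSup hy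
  obtain ⟨L, -, hL⟩ := hf
  refine ⟨_, _, hl, hu, fun x => ⟨fun hx => ⟨hle x hx, hge x hx, fun i j h => h x hx⟩, ?_⟩⟩
  rintro ⟨hlx, hxu, hag⟩
  exact (hL x).2 fun a ha => ImpAtom.holds_of_agree (fun y hy => (hL y).1 hy a ha) hl hu
    (fun y hy => hcompl _ hl _ hu y hy (hle y hy) (hge y hy)) hlx hxu hag

theorem HasImpSupport.exists_not_modular (hf : f.HasImpSupport) (hED : f ∉ ED) :
    ∃ v w, f.val (v ⊓ w) ≠ 0 ∧ f.val v ≠ 0 ∧ f.val (v ⊔ w) ≠ 0 ∧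
      (f.val v * f.val w < f.val (v ⊓ w) * f.val (v ⊔ w) ∨
        f.val w ≠ 0 ∧ f.val (v ⊓ w) * f.val (v ⊔ w) < f.val v * f.val w) := by
  by_contra! hmod
  refine hED ?_
  obtain ⟨i₀⟩ := hf.nonempty_fin
  obtain hempty | hne := f.support.eq_empty_or_nonempty
  · have hzero : f.val = fun _ => 0 := Function.support_eq_empty_iff.1 hempty
    exact mem_ED_iff.2 (hzero ▸ comp_eval_mem_edFunctions i₀ fun _ => 0)
  obtain ⟨l, u, hlu⟩ := hf.exists_isSubcube hne fun l hl u hu y hy hly hyu => by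
    have hinf : y ⊓ (l ⊔ (u ⊓ yᶜ)) = l := by
      rw [inf_sup_left, inf_eq_right.2 hly, inf_left_comm, inf_compl_eq_bot, inf_bot_eq, sup_bot_eq]
    have hsup : y ⊔ (l ⊔ (u ⊓ yᶜ)) = u := by
      rw [← sup_assoc, sup_eq_left.2 hly, sup_inf_left, sup_compl_eq_top, inf_top_eq,
        sup_eq_right.2 hyu]
    have hle := (hmod y (l ⊔ (u ⊓ yᶜ)) (by rwa [hinf]) hy (by rwa [hsup])).1
    rw [hinf, hsup] at hle
    exact right_ne_zero_of_mul (ne_of_gt ((pos_iff_ne_zero.2 (mul_ne_zero hl hu)).trans_le hle))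
  refine mem_ED_iff.2 (hlu.mem_edFunctions hf.supClosed (fun x hx y hy => ?_) i₀)
  have h := hmod x y (hf.infClosed hx hy) hx (hf.supClosed hx hy)
  exact le_antisymm (h.2 hy) h.1

end ImpSupport

end Constraint

/-! ### Gadgets for `Implies` -/

namespace Constraint

section Gadget

variable {f : Constraint}

/-- `G` approximates `Implies(x₀, x₁)` by constraints from `{f} ∪ 𝒰`; the variables `x₂`, `x₃`, `x₄`
are auxiliary. -/
structure IsGadget (f : Constraint) (G : List (Applied 5)) : Prop where
  mem : ∀ a ∈ G, a.con ∈ {f} ∪ unary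
  le_one : ∀ x, prodEval G x ≤ 1
  le_half : ∀ x, x 0 = true → x 1 = false → prodEval G x ≤ 1 / 2
  eq_one : ∀ b₀ b₁ : Bool, (b₀ = true → b₁ = true) →
    ∃ z₀ z₁ z₂, prodEval G ![b₀, b₁, z₀, z₁, z₂] = 1

/-- The function `g` on five variables is a product of constraints from `{f} ∪ 𝒰`, as long as the
variables `x₂` and `x₃` stand for the constants `0` and `1`. -/
def Realizes (f : Constraint) (g : (Fin 5 → Bool) → ℝ≥0) : Prop :=
  ∃ G : List (Applied 5), (∀ a ∈ G, a.con ∈ {f} ∪ unary) ∧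
    ∀ x, x 2 = false → x 3 = true → prodEval G x = g x

theorem Realizes.mul {g h : (Fin 5 → Bool) → ℝ≥0} (hg : Realizes f g) (hh : Realizes f h) :
    Realizes f (g * h) := by
  obtain ⟨G, hG, hGg⟩ := hg
  obtain ⟨H, hH, hHh⟩ := hh
  refine ⟨G ++ H, fun a ha => (List.mem_append.1 ha).elim (hG a) (hH a), fun x h₂ h₃ => ?_⟩
  rw [prodEval_append, hGg x h₂ h₃, hHh x h₂ h₃, Pi.mul_apply]

theorem Realizes.pow {g : (Fin 5 → Bool) → ℝ≥0} (hg : Realizes f g) (m : ℕ) :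
    Realizes f (g ^ m) := by
  induction m with
  | zero => exact ⟨[], by simp, fun _ _ _ => rfl⟩
  | succ m ih => exact pow_succ g m ▸ ih.mul hg

theorem realizes_eval {a : Applied 5} (ha : a.con ∈ {f} ∪ unary) : Realizes f a.eval :=
  ⟨[a], by simpa using ha, fun _ _ _ => mul_one _⟩

theorem realizes_unary (p : Fin 5) (g : Bool → ℝ≥0) : Realizes f fun x => g (x p) :=
  realizes_eval (a := ⟨⟨1, fun x => g (x 0)⟩, fun _ => p⟩) (Or.inr rfl)

theorem Realizes.exists_isGadget {g : (Fin 5 → Bool) → ℝ≥0} (hg : Realizes f g)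
    (hle : ∀ x, g x ≤ 1) (hhalf : ∀ x, x 0 = true → x 1 = false → g x ≤ 1 / 2)
    (hone : ∀ b₀ b₁ : Bool, (b₀ = true → b₁ = true) → ∃ z, g ![b₀, b₁, false, true, z] = 1) :
    ∃ G, IsGadget f G := by
  obtain ⟨G, hG, hGg⟩ := hg
  let pin (p : Fin 5) (b : Bool) : Applied 5 := ⟨⟨1, fun x => if x 0 = b then 1 else 0⟩, fun _ => p⟩
  have hval (x) : prodEval (pin 2 false :: pin 3 true :: G) x =
      if x 2 = false ∧ x 3 = true then g x else 0 := by
    simp only [prodEval, pin, Applied.eval, List.map_cons, List.prod_cons] at hGg ⊢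
    by_cases h₂ : x 2 = false <;> by_cases h₃ : x 3 = true <;> simp [h₂, h₃, hGg]
  refine ⟨pin 2 false :: pin 3 true :: G, fun a ha => ?_, fun x => ?_, fun x h₀ h₁ => ?_,
    fun b₀ b₁ hb => ?_⟩
  · obtain rfl | rfl | ha : a = pin 2 false ∨ a = pin 3 true ∨ a ∈ G := by simpa using ha
    exacts [Or.inr rfl, Or.inr rfl, hG a ha]
  · rw [hval]
    split_ifs
    exacts [hle x, zero_le_one]
  · rw [hval]
    split_ifs
    exacts [hhalf x h₀ h₁, zero_le]
  · obtain ⟨z, hz⟩ := hone b₀ b₁ hb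
    exact ⟨false, true, z, by rw [hval, if_pos ⟨rfl, rfl⟩, hz]⟩

theorem Realizes.exists_isGadget_of_lt_one {g : (Fin 5 → Bool) → ℝ≥0} (hg : Realizes f g) {δ : ℝ≥0}
    (hδ : δ < 1) (hle : ∀ x, g x ≤ 1) (hlt : ∀ x, x 0 = true → x 1 = false → g x ≤ δ)
    (hone : ∀ b₀ b₁ : Bool, (b₀ = true → b₁ = true) → ∃ z, g ![b₀, b₁, false, true, z] = 1) :
    ∃ G, IsGadget f G := by
  obtain ⟨m, hm⟩ := exists_pow_lt_of_lt_one (show (0 : ℝ≥0) < 1 / 2 by positivity) hδ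
  refine (hg.pow m).exists_isGadget (fun x => pow_le_one₀ zero_le (hle x))
    (fun x h₀ h₁ => (pow_le_pow_left₀ zero_le (hlt x h₀ h₁) m).trans hm.le) fun b₀ b₁ hb => ?_
  obtain ⟨z, hz⟩ := hone b₀ b₁ hb
  exact ⟨z, by rw [Pi.pow_apply, hz, one_pow]⟩

end Gadget

section SoftClause

variable {k : ℕ}

/-- The four points `v ⊓ w`, `v`, `w`, `v ⊔ w`, indexed by `00`, `01`, `10`, `11`. -/
def corner (v w : Fin k → Bool) (a b : Bool) : Fin k → Bool :=
  fun i => if v i = w i then v i else if w i = true then a else b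

theorem corner_false_false (v w : Fin k → Bool) : corner v w false false = v ⊓ w := by
  funext i
  cases hv : v i <;> cases hw : w i <;> simp [corner, hv, hw]

theorem corner_false_true (v w : Fin k → Bool) : corner v w false true = v := by
  funext i
  cases hv : v i <;> cases hw : w i <;> simp [corner, hv, hw]

theorem corner_true_false (v w : Fin k → Bool) : corner v w true false = w := by
  funext i
  cases hv : v i <;> cases hw : w i <;> simp [corner, hv, hw]

theorem corner_true_true (v w : Fin k → Bool) : corner v w true true = v ⊔ w := by
  funext i
  cases hv : v i <;> cases hw : w i <;> simp [corner, hv, hw]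

theorem realizes_corner {f : Constraint} (v w : Fin f.arity → Bool) (p q : Fin 5) :
    Realizes f fun x => f.val (corner v w (x p) (x q)) := by
  obtain ⟨G, hG, hGf⟩ := realizes_eval (f := f) (a := ⟨f, fun i =>
    if v i = w i then (if v i = true then 3 else 2) else if w i = true then p else q⟩) (Or.inl rfl)
  refine ⟨G, hG, fun x h₂ h₃ => (hGf x h₂ h₃).trans (congrArg f.val (funext fun i => ?_))⟩
  cases hv : v i <;> cases hw : w i <;> simp [corner, hv, hw, h₂, h₃]

theorem exists_rescaling {K : Type*} [CommGroupWithZero K] {g : Bool → Bool → K} {a b : Bool}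
    (h₁ : g a (!b) ≠ 0) (h₂ : g (!a) b ≠ 0) (h₃ : g (!a) (!b) ≠ 0) :
    ∃ α β : Bool → K, ∀ s t, g s t * (α s * β t) =
      if s = a ∧ t = b then g a b * g (!a) (!b) / (g a (!b) * g (!a) b) else 1 := by
  refine ⟨fun s => if s = a then g (!a) (!b) / g a (!b) else 1,
    fun t => if t = b then 1 / g (!a) b else 1 / g (!a) (!b), fun s t => ?_⟩
  obtain rfl | rfl := Bool.eq_or_eq_not s a <;> obtain rfl | rfl := Bool.eq_or_eq_not t b <;>
    simp <;> field_simp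

/-- The constraint that penalizes `x_p = a`, `x_q = b` by the factor `δ`. -/
def softClause (δ : ℝ≥0) (p : Fin 5) (a : Bool) (q : Fin 5) (b : Bool) (x : Fin 5 → Bool) : ℝ≥0 :=
  if x p = a ∧ x q = b then δ else 1

theorem softClause_le_one {δ : ℝ≥0} (hδ : δ ≤ 1) (p : Fin 5) (a : Bool) (q : Fin 5) (b : Bool)
    (x : Fin 5 → Bool) : softClause δ p a q b x ≤ 1 := by
  unfold softClause
  split_ifs
  exacts [hδ, le_rfl]

variable {f : Constraint} {v w : Fin f.arity → Bool}

theorem realizes_softClause {a b : Bool} (h₁ : f.val (corner v w a (!b)) ≠ 0)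
    (h₂ : f.val (corner v w (!a) b) ≠ 0) (h₃ : f.val (corner v w (!a) (!b)) ≠ 0) (p q : Fin 5) :
    Realizes f (softClause (f.val (corner v w a b) * f.val (corner v w (!a) (!b)) /
      (f.val (corner v w a (!b)) * f.val (corner v w (!a) b))) p a q b) := by
  obtain ⟨α, β, h⟩ := exists_rescaling (g := fun s t => f.val (corner v w s t)) h₁ h₂ h₃
  have hreal := (realizes_corner v w p q).mul ((realizes_unary p α).mul (realizes_unary q β))
  convert hreal using 1
  exact funext fun x => (h (x p) (x q)).symm

theorem exists_isGadget_of_mul_lt_mul (h₀₀ : f.val (v ⊓ w) ≠ 0) (h₀₁ : f.val v ≠ 0)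
    (h₁₁ : f.val (v ⊔ w) ≠ 0) (h : f.val v * f.val w < f.val (v ⊓ w) * f.val (v ⊔ w)) :
    ∃ G, IsGadget f G := by
  have hreal := realizes_softClause (f := f) (v := v) (w := w) (a := true) (b := false)
    (by simpa [corner_true_true]) (by simpa [corner_false_false]) (by simpa [corner_false_true]) 0 1
  simp only [Bool.not_true, Bool.not_false, corner_false_false, corner_false_true,
    corner_true_false, corner_true_true] at hreal
  have hδ : f.val w * f.val v / (f.val (v ⊔ w) * f.val (v ⊓ w)) < 1 := by
    rw [mul_comm (f.val w), mul_comm (f.val (v ⊔ w))]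
    exact (div_lt_one (by positivity)).2 h
  refine hreal.exists_isGadget_of_lt_one hδ (softClause_le_one hδ.le 0 true 1 false)
    (fun x hx₀ hx₁ => (if_pos ⟨hx₀, hx₁⟩).le) fun b₀ b₁ hb => ⟨false, if_neg ?_⟩
  rintro ⟨rfl : b₀ = true, rfl : b₁ = false⟩
  exact absurd (hb rfl) Bool.false_ne_true

-- `x₄` is forced to be the negation of `x₀` by a soft OR and a soft NAND.
theorem exists_isGadget_of_lt_mul_mul (h₀₀ : f.val (v ⊓ w) ≠ 0) (h₀₁ : f.val v ≠ 0)
    (h₁₀ : f.val w ≠ 0) (h₁₁ : f.val (v ⊔ w) ≠ 0)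
    (h : f.val (v ⊓ w) * f.val (v ⊔ w) < f.val v * f.val w) : ∃ G, IsGadget f G := by
  set δ := f.val (v ⊓ w) * f.val (v ⊔ w) / (f.val v * f.val w) with hδ_def
  have hδ : δ < 1 := (div_lt_one (by positivity)).2 h
  have hor (p q) : Realizes f (softClause δ p false q false) := by
    simpa [corner_false_false, corner_false_true, corner_true_false, corner_true_true] using
      realizes_softClause (f := f) (v := v) (w := w) (a := false) (b := false)
        (by simpa [corner_false_true]) (by simpa [corner_true_false])
        (by simpa [corner_true_true]) p q
  have hnand (p q) : Realizes f (softClause δ p true q true) := by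
    have := realizes_softClause (f := f) (v := v) (w := w) (a := true) (b := true)
        (by simpa [corner_true_false]) (by simpa [corner_false_true])
        (by simpa [corner_false_false]) p q
    simpa [corner_false_false, corner_false_true, corner_true_false, corner_true_true, hδ_def,
      mul_comm] using this
  refine ((hor 0 4).mul ((hnand 0 4).mul (hor 4 1))).exists_isGadget_of_lt_one hδ
    (fun x => ?_) (fun x hx₀ hx₁ => ?_) fun b₀ b₁ hb => ⟨!b₀, ?_⟩
  · exact mul_le_one' (softClause_le_one hδ.le ..)
      (mul_le_one' (softClause_le_one hδ.le ..) (softClause_le_one hδ.le ..))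
  · cases hx₄ : x 4 <;> simp [softClause, hx₀, hx₁, hx₄]
  · cases b₀ <;> cases b₁ <;> simp_all [softClause]

theorem HasImpSupport.exists_isGadget (hf : f.HasImpSupport)
    (h : ¬ f.HasAffineSupport ∨ f ∉ ED) : ∃ G, IsGadget f G := by
  have hED : f ∉ ED := h.elim (mt hasAffineSupport_of_mem_ED) id
  obtain ⟨v, w, h₀₀, h₀₁, h₁₁, hlt | ⟨h₁₀, hlt⟩⟩ := hf.exists_not_modular hED
  · exact exists_isGadget_of_mul_lt_mul h₀₀ h₀₁ h₁₁ hlt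
  · exact exists_isGadget_of_lt_mul_mul h₀₀ h₀₁ h₁₀ h₁₁ hlt

end SoftClause

end Constraint

/-! ### Runs of programs -/

theorem Config.run_halted (M : Oracle) (t : ℕ) (μ : Memory) :
    Config.run M t ⟨[], μ⟩ = PMF.pure ⟨[], μ⟩ := by
  induction t with
  | zero => rfl
  | succ t ih => rw [Config.run, Config.step, PMF.pure_bind, ih]

/-- `Reach M t C D`: with oracle `M`, the configuration `C` turns into `D` after exactly `t` steps,
none of which involves randomness or the oracle. -/
inductive Reach (M : Oracle) : ℕ → Config → Config → Prop
  | refl (C : Config) : Reach M 0 C C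
  | step {t : ℕ} {C C' D : Config} (hcalls : ∀ w, ¬ C.Calls w)
      (hstep : Config.step M C = PMF.pure C') (h : Reach M t C' D) : Reach M (t + 1) C D

namespace Reach

variable {M : Oracle} {s t : ℕ} {C D E : Config}

theorem trans (h : Reach M s C D) (h' : Reach M t D E) : Reach M (s + t) C E := by
  induction h with
  | refl C => simpa using h'
  | step hcalls hstep _ ih => simpa only [Nat.add_right_comm] using step hcalls hstep (ih h')

theorem run_add (h : Reach M s C D) (t : ℕ) : Config.run M (s + t) C = Config.run M t D := by
  induction h with
  | refl C => simp
  | step _ hstep _ ih => rw [Nat.add_right_comm, Config.run, hstep, PMF.pure_bind, ih]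

theorem not_calls (h : Reach M s C D) (ht : t < s) (hE : E ∈ (Config.run M t C).support)
    (w : List ℝ) : ¬ E.Calls w := by
  induction h generalizing t with
  | refl C => omega
  | step hcalls hstep _ ih =>
    cases t with
    | zero =>
      obtain rfl : E = _ := by simpa [Config.run] using hE
      exact hcalls w
    | succ t =>
      rw [Config.run, hstep, PMF.pure_bind] at hE
      exact ih (by omega) hE

end Reach

/-- Big-step semantics of programs without oracle calls and coin tosses: `Exec c μ ν t` says that
`c` takes the memory `μ` to `ν` in exactly `t` steps. -/
inductive Exec : Prog → Memory → Memory → ℕ → Prop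
  | skip (μ : Memory) : Exec .skip μ μ 1
  | const (s : ℕ) (r : ℝ) (μ : Memory) : Exec (.const s r) μ (μ.push s r) 1
  | pop (s : ℕ) (μ : Memory) : Exec (.pop s) μ (Function.update μ s (μ s).tail) 1
  | copy (s t : ℕ) (μ : Memory) : Exec (.copy s t) μ (μ.push t (μ.top s)) 1
  | arith (op : ArithOp) (s t u : ℕ) (μ : Memory) :
      Exec (.arith op s t u) μ (μ.push u (op.apply (μ.top s) (μ.top t))) 1
  | seq {c d : Prog} {μ ν ξ : Memory} {s t : ℕ} (hc : Exec c μ ν s) (hd : Exec d ν ξ t) :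
      Exec (.seq c d) μ ξ (s + t + 1)
  | cond_pos {b : Test} {c d : Prog} {μ ν : Memory} {t : ℕ} (hb : b.Holds μ)
      (h : Exec c μ ν t) : Exec (.cond b c d) μ ν (t + 1)
  | cond_neg {b : Test} {c d : Prog} {μ ν : Memory} {t : ℕ} (hb : ¬ b.Holds μ)
      (h : Exec d μ ν t) : Exec (.cond b c d) μ ν (t + 1)
  | loop_done {b : Test} {c : Prog} {μ : Memory} (hb : ¬ b.Holds μ) : Exec (.loop b c) μ μ 1
  | loop_step {b : Test} {c : Prog} {μ ν ξ : Memory} {s t : ℕ} (hb : b.Holds μ)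
      (hc : Exec c μ ν s) (h : Exec (.loop b c) ν ξ t) : Exec (.loop b c) μ ξ (s + t + 1)

theorem Exec.reach {c : Prog} {μ ν : Memory} {t : ℕ} (h : Exec c μ ν t) (M : Oracle)
    (k : List Prog) : Reach M t ⟨c :: k, μ⟩ ⟨k, ν⟩ := by
  have not_calls {c : Prog} (hc : ∀ q a, c ≠ .call q a) (k : List Prog) (μ : Memory) (w : List ℝ) :
      ¬ Config.Calls ⟨c :: k, μ⟩ w := fun ⟨q, a, _, h, _⟩ => hc q a (List.cons.inj h).1
  induction h generalizing k with
  | skip | const | pop | copy | arith =>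
    exact .step (not_calls (by simp) _ _) (by simp only [Config.step]) (.refl _)
  | seq _ _ ihc ihd =>
    exact .step (not_calls (by simp) _ _) (by simp only [Config.step]) ((ihc _).trans (ihd k))
  | cond_pos hb _ ih | cond_neg hb _ ih =>
    exact .step (not_calls (by simp) _ _) (by simp only [Config.step, hb, if_true, if_false]) (ih k)
  | loop_done hb =>
    exact .step (not_calls (by simp) _ _) (by simp only [Config.step, hb, if_false]) (.refl _)
  | loop_step hb _ _ ihc ihl =>
    exact .step (not_calls (by simp) _ _) (by simp only [Config.step, hb, if_true])
      ((ihc _).trans (ihl k))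

/-! ### The memory of the reduction -/

/-- The stacks that are used by the reduction, in the order of their numbers, which are named in
the namespace `Reg`. -/
structure Store where
  input : List ℝ := []
  output : List ℝ := []
  eps : List ℝ := []
  processed : List ℝ := []
  bound : List ℝ := []
  one : List ℝ := []
  temp : List ℝ := []
  newVars : List ℝ := []
  vars : List ℝ := []
  query : List ℝ := []
  x : List ℝ := []
  y : List ℝ := []
  z₀ : List ℝ := []
  z₁ : List ℝ := []
  z₂ : List ℝ := []
  entries : List ℝ := []
  indices : List ℝ := []
  flag : List ℝ := []
  power : List ℝ := []
  answer : List ℝ := []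

namespace Reg

abbrev input : ℕ := 0
abbrev output : ℕ := 1
abbrev eps : ℕ := 2
abbrev processed : ℕ := 3
abbrev bound : ℕ := 4
abbrev one : ℕ := 5
abbrev temp : ℕ := 6
abbrev newVars : ℕ := 7
abbrev vars : ℕ := 8
abbrev query : ℕ := 9
abbrev x : ℕ := 10
abbrev y : ℕ := 11
abbrev z₀ : ℕ := 12
abbrev z₁ : ℕ := 13
abbrev z₂ : ℕ := 14
abbrev entries : ℕ := 15
abbrev indices : ℕ := 16
abbrev flag : ℕ := 17
abbrev power : ℕ := 18
abbrev answer : ℕ := 19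

end Reg

/-- The memory with the stacks `l`, all further stacks being empty. -/
def Memory.ofList (l : List (List ℝ)) : Memory := fun s => l.getD s []

theorem Memory.update_ofList {l : List (List ℝ)} {s : ℕ} (hs : s < l.length) (w : List ℝ) :
    Function.update (ofList l) s w = ofList (l.set s w) := by
  funext t
  obtain rfl | h := eq_or_ne t s
  · simp [ofList, hs]
  · simp [ofList, h, List.getD_eq_getElem?_getD, h.symm]

namespace Store

/-- The list of all stacks. -/
def toList (S : Store) : List (List ℝ) :=
  [S.input, S.output, S.eps, S.processed, S.bound, S.one, S.temp, S.newVars, S.vars, S.query,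
    S.x, S.y, S.z₀, S.z₁, S.z₂, S.entries, S.indices, S.flag, S.power, S.answer]

/-- The memory that consists of the given stacks. -/
def mem (S : Store) : Memory := .ofList S.toList

end Store

/-- `Runs c S T k`: the program `c` takes the store `S` to the store `T` in at most `k` steps,
without oracle calls and coin tosses. -/
def Runs (c : Prog) (S T : Store) (k : ℕ) : Prop := ∃ t ≤ k, Exec c S.mem T.mem t

namespace Runs

variable {b : Test} {c d : Prog} {S T U : Store} {k l : ℕ}

theorem mono (h : Runs c S T k) (hkl : k ≤ l) : Runs c S T l :=
  h.imp fun _ ⟨ht, h⟩ => ⟨ht.trans hkl, h⟩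

theorem seq (hc : Runs c S T k) (hd : Runs d T U l) : Runs (.seq c d) S U (k + l + 1) := by
  obtain ⟨s, hs, hc⟩ := hc
  obtain ⟨t, ht, hd⟩ := hd
  exact ⟨_, by omega, hc.seq hd⟩

theorem cond_pos (hb : b.Holds S.mem) (h : Runs c S T k) : Runs (.cond b c d) S T (k + 1) := by
  obtain ⟨t, ht, h⟩ := h
  exact ⟨_, by omega, h.cond_pos hb⟩

theorem cond_neg (hb : ¬ b.Holds S.mem) (h : Runs d S T k) : Runs (.cond b c d) S T (k + 1) := by
  obtain ⟨t, ht, h⟩ := h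
  exact ⟨_, by omega, h.cond_neg hb⟩

theorem loop_done (hb : ¬ b.Holds S.mem) : Runs (.loop b c) S S 1 := ⟨1, le_rfl, .loop_done hb⟩

theorem loop_step (hb : b.Holds S.mem) (hc : Runs c S T k) (h : Runs (.loop b c) T U l) :
    Runs (.loop b c) S U (k + l + 1) := by
  obtain ⟨s, hs, hc⟩ := hc
  obtain ⟨t, ht, h⟩ := h
  exact ⟨_, by omega, .loop_step hb hc h⟩

end Runs

namespace Prog

/-- Sequential composition of a list of programs. -/
def block : List Prog → Prog
  | [] => .skip
  | [c] => c
  | c :: d :: l => .seq c (block (d :: l))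

/-- Run `c`, ask the oracle about the word on stack `query`, and run `d` on its answer. -/
abbrev withCall (c d : Prog) : Prog :=
  .block [c, .call Reg.query Reg.answer, d]

/-- Straight-line programs that write only on the stacks below `n`. -/
def isStraight (n : ℕ) : Prog → Bool
  | .skip => true
  | .const s _ => decide (s < n)
  | .pop s => decide (s < n)
  | .copy _ t => decide (t < n)
  | .arith _ _ _ u => decide (u < n)
  | .seq c d => c.isStraight n && d.isStraight n
  | _ => false

/-- The effect of a straight-line program on a list of stacks. -/
noncomputable def effect : Prog → List (List ℝ) → List (List ℝ)
  | .const s r, l => l.set s (r :: l.getD s [])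
  | .pop s, l => l.set s (l.getD s []).tail
  | .copy s t, l => l.set t ((l.getD s []).headD 0 :: l.getD t [])
  | .arith op s t u, l =>
      l.set u (op.apply ((l.getD s []).headD 0) ((l.getD t []).headD 0) :: l.getD u [])
  | .seq c d, l => d.effect (c.effect l)
  | _, l => l

/-- The number of steps of a straight-line program. -/
def cost : Prog → ℕ
  | .seq c d => c.cost + d.cost + 1
  | _ => 1

theorem length_effect (c : Prog) (l : List (List ℝ)) : (c.effect l).length = l.length := by
  induction c generalizing l with
  | seq c d ihc ihd => rw [effect, ihd, ihc]
  | _ => simp [effect]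

/-- Erase stack `s`. -/
def clear (s : ℕ) : Prog := .loop (.nonempty s) (.pop s)

/-- Move the entries of stack `s` one by one to stack `t`, which reverses their order. -/
def move (s t : ℕ) : Prog := .loop (.nonempty s) (.seq (.copy s t) (.pop s))

end Prog

namespace Exec

theorem straight {c : Prog} {l : List (List ℝ)} (h : c.isStraight l.length = true) :
    Exec c (.ofList l) (.ofList (c.effect l)) c.cost := by
  induction c generalizing l with
  | skip => exact .skip _
  | const s r => exact Memory.update_ofList (of_decide_eq_true h) _ ▸ .const s r _
  | pop s => exact Memory.update_ofList (of_decide_eq_true h) _ ▸ .pop s _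
  | copy s t => exact Memory.update_ofList (of_decide_eq_true h) _ ▸ .copy s t _
  | arith op s t u => exact Memory.update_ofList (of_decide_eq_true h) _ ▸ .arith op s t u _
  | seq c d ihc ihd =>
    obtain ⟨hc, hd⟩ := Bool.and_eq_true_iff.1 h
    exact (ihc hc).seq (ihd (by rwa [Prog.length_effect]))
  | _ => exact absurd h Bool.false_ne_true

theorem clear (s : ℕ) (μ : Memory) :
    Exec (.clear s) μ (Function.update μ s []) (2 * (μ s).length + 1) := by
  unfold Prog.clear
  generalize hw : μ s = w
  induction w generalizing μ with
  | nil =>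
    rw [← hw, Function.update_eq_self, hw]
    exact .loop_done (by simp [Test.Holds, hw])
  | cons r w ih =>
    have hpop := Exec.pop s μ
    have hrest := ih (Function.update μ s w) (by simp)
    rw [hw, List.tail_cons] at hpop
    rw [Function.update_idem] at hrest
    convert Exec.loop_step (by simp [Test.Holds, hw]) hpop hrest using 1
    simp only [List.length_cons]
    ring

theorem move {s t : ℕ} (hst : s ≠ t) (μ : Memory) :
    Exec (.move s t) μ (Function.update (Function.update μ s []) t ((μ s).reverse ++ μ t))
      (4 * (μ s).length + 1) := by
  unfold Prog.move
  generalize hw : μ s = w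
  induction w generalizing μ with
  | nil =>
    rw [← hw, Function.update_eq_self, hw, List.reverse_nil, List.nil_append,
      Function.update_eq_self]
    exact .loop_done (by simp [Test.Holds, hw])
  | cons r w ih =>
    have hpush := (Exec.copy s t μ).seq (.pop s _)
    simp only [Memory.push, Memory.top, hw, List.headD_cons, ne_eq, hst, not_false_eq_true,
      Function.update_of_ne, List.tail_cons] at hpush
    have hrest := ih _ (Function.update_self s w (Function.update μ t (r :: μ t)))
    convert Exec.loop_step (by simp [Test.Holds, hw]) hpush hrest using 1
    · funext u
      obtain rfl | hut := eq_or_ne u t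
      · simp [hst.symm]
      · obtain rfl | hus := eq_or_ne u s <;> simp [*]
    · simp only [List.length_cons]
      ring

end Exec

namespace Runs

variable {S T : Store} {s t : ℕ}

theorem straight {c : Prog} (hc : c.isStraight S.toList.length = true)
    (hT : c.effect S.toList = T.toList) : Runs c S T c.cost :=
  ⟨_, le_rfl, by simpa only [Store.mem, ← hT] using Exec.straight hc⟩

theorem clear {w : List ℝ} (hs : decide (s < S.toList.length) = true) (hw : S.toList.getD s [] = w)
    (hT : S.toList.set s [] = T.toList) : Runs (.clear s) S T (2 * w.length + 1) := by
  refine ⟨_, le_rfl, ?_⟩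
  rw [Store.mem, Store.mem, ← hT, ← Memory.update_ofList (of_decide_eq_true hs), ← hw]
  exact Exec.clear s _

theorem move {w : List ℝ} (hst : s ≠ t) (hs : decide (s < S.toList.length) = true)
    (ht : decide (t < S.toList.length) = true) (hw : S.toList.getD s [] = w)
    (hT : (S.toList.set s []).set t (w.reverse ++ S.toList.getD t []) = T.toList) :
    Runs (.move s t) S T (4 * w.length + 1) := by
  refine ⟨_, le_rfl, ?_⟩
  rw [Store.mem, Store.mem, ← hT, ← Memory.update_ofList (by simpa using of_decide_eq_true ht),
    ← Memory.update_ofList (of_decide_eq_true hs), ← hw]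
  exact Exec.move hst _

end Runs

/-! ### Encodings -/

theorem Constraint.length_table (k : ℕ) (g : (Fin k → Bool) → ℝ≥0) :
    (Constraint.table k g).length = 2 ^ k := by
  induction k with
  | zero => rfl
  | succ k ih => simp [Constraint.table, ih, pow_succ, mul_two]

theorem Constraint.table_two (g : (Fin 2 → Bool) → ℝ≥0) :
    Constraint.table 2 g =
      [g ![false, false], g ![false, true], g ![true, false], g ![true, true]] := by
  have cons_cons (a b : Bool) :
      (Fin.cons a (Fin.cons b Fin.elim0 : Fin 1 → Bool) : Fin 2 → Bool) = ![a, b] := by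
    funext i; fin_cases i <;> rfl
  simp only [Constraint.table, List.cons_append, List.nil_append]
  exact congrArg₂ _ (congrArg g (cons_cons _ _)) (congrArg₂ _ (congrArg g (cons_cons _ _))
    (congrArg₂ _ (congrArg g (cons_cons _ _)) (congrArg₂ _ (congrArg g (cons_cons _ _)) rfl)))

namespace Reduction

theorem encList_eq_flatMap (l : List (List ℝ)) : encList l = l.flatMap (1 :: ·) ++ [0] := by
  induction l with
  | nil => rfl
  | cons w l ih => simp [encList, ih]

theorem encList_replicate_nil (n : ℕ) : encList (.replicate n []) = .replicate n 1 ++ [0] := by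
  induction n with
  | zero => rfl
  | succ n ih => simp [List.replicate_succ, encList, ih]

/-- The encoding of a list of numbers. -/
def encNums (l : List ℝ) : List ℝ := encList (l.map fun r => [r])

theorem encNums_eq_flatMap (l : List ℝ) : encNums l = l.flatMap (fun r => [1, r]) ++ [0] := by
  rw [encNums, encList_eq_flatMap, List.flatMap_map]

theorem length_encNums (l : List ℝ) : (encNums l).length = 2 * l.length + 1 := by
  induction l with
  | nil => rfl
  | cons r l ih => simp_all [encNums, encList]; omega

/-- A constraint applied to variables that are given by their indices, without a bound on the number
of variables. -/
structure RawApplied where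
  con : Constraint
  scope : Fin con.arity → ℕ

namespace RawApplied

/-- The indices of the variables, as real numbers. -/
def indices (a : RawApplied) : List ℝ := List.ofFn fun i => (a.scope i : ℝ)

/-- The table of the values of the constraint, as real numbers. -/
def values (a : RawApplied) : List ℝ :=
  (Constraint.table a.con.arity a.con.val).map fun r : ℝ≥0 => (r : ℝ)

/-- The encoding of an applied constraint as a word, as in `Constraint.Applied.enc`. -/
def enc (a : RawApplied) : List ℝ := encNums a.indices ++ encNums a.values

/-- The encoding of a list of applied constraints, without its end mark. -/
def encAll (l : List RawApplied) : List ℝ := l.flatMap fun a => 1 :: a.enc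

/-- The index of variable number `k` of an applied constraint, and `0` if there is no such
variable. -/
def index (a : RawApplied) (k : ℕ) : ℕ := (List.ofFn a.scope).getD k 0

theorem encList_map_enc (l : List RawApplied) : encList (l.map enc) = encAll l ++ [0] := by
  rw [encList_eq_flatMap, List.flatMap_map, encAll]

theorem length_le_length_encAll (l : List RawApplied) : l.length ≤ (encAll l).length := by
  rw [encAll, List.length_flatMap, ← List.length_map fun a : RawApplied => (1 :: a.enc).length]
  exact List.length_le_sum_of_one_le _ (by simp)

theorem length_enc (a : RawApplied) :
    a.enc.length = 2 * a.indices.length + 2 * a.values.length + 2 := by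
  simp only [enc, List.length_append, length_encNums]
  omega

theorem exists_eq_implies {a : RawApplied} (h : a.con = Constraint.implies) :
    ∃ i j, a = ⟨Constraint.implies, ![i, j]⟩ := by
  obtain ⟨con, s⟩ := a
  subst h
  change Fin 2 → ℕ at s
  exact ⟨s 0, s 1, congrArg _ (funext fun k : Fin 2 => by fin_cases k <;> rfl)⟩

theorem indices_of_implies {a : RawApplied} (h : a.con = Constraint.implies) :
    a.indices = [(a.index 0 : ℝ), (a.index 1 : ℝ)] := by
  obtain ⟨i, j, rfl⟩ := exists_eq_implies h
  simp [indices, index, Constraint.implies]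

theorem values_eq_iff (a : RawApplied) :
    a.values = [1, 1, 0, 1] ↔ a.con = Constraint.implies := by
  obtain ⟨⟨k, g⟩, s⟩ := a
  simp only [values]
  constructor
  · intro h
    have hk : 2 ^ k = 2 ^ 2 := by simpa [Constraint.length_table] using congrArg List.length h
    obtain rfl : k = 2 := Nat.pow_right_injective le_rfl hk
    simp only [Constraint.table_two, List.map_cons, List.map_nil, List.cons.injEq, and_true,
      NNReal.coe_eq_one, NNReal.coe_eq_zero] at h
    rw [Constraint.implies]
    congr 1
    funext x
    have hx : x = ![x 0, x 1] := by funext i; fin_cases i <;> rfl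
    rw [hx]
    cases x 0 <;> cases x 1 <;> simp [h]
  · rintro ⟨⟩
    simp [Constraint.table_two]

end RawApplied

/-! ### The program -/

/-- Symbols to be written: constants, or the content of the stack of one of the five variables
`x`, `y`, `z₀`, `z₁`, `z₂` of the gadget. -/
abbrev Sym := ℝ ⊕ Fin 5

/-- The encoding of an applied constraint of the gadget as a word of symbols. -/
def symbols (a : Constraint.Applied 5) : List Sym :=
  (List.ofFn a.scope).flatMap (fun v => [.inl 1, .inr v]) ++ .inl 0 ::
    ((Constraint.table a.con.arity a.con.val).flatMap (fun r => [.inl 1, .inl (r : ℝ)]) ++ [.inl 0])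

/-- The encoding of the gadget as a word of symbols, without an end mark. -/
def symbolsAll (G : List (Constraint.Applied 5)) : List Sym :=
  G.flatMap fun a => .inl 1 :: symbols a

/-- Write the symbols on stack `query`. -/
def emit : List Sym → Prog
  | [] => .skip
  | .inl r :: ys => .seq (emit ys) (.const Reg.query r)
  | .inr v :: ys => .seq (emit ys) (.copy (Reg.x + v) Reg.query)

/-- Replace the top of stack `u` by the value of `op` at the tops of stacks `s` and `t`. -/
def assign (op : ArithOp) (s t u : ℕ) : Prog :=
  .block [.arith op s t Reg.temp, .pop u, .copy Reg.temp u, .pop Reg.temp]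

/-- Branch on whether the tops of stacks `s` and `t` are equal. -/
def ifEq (s t : ℕ) (c d : Prog) : Prog := .cond (.le s t) (.cond (.le t s) c d) d

/-- Read a list of numbers from stack `input`, push its encoding on stack `processed` and its
entries on stack `entries`. -/
def readNums : Prog := .block [
  .loop (.le Reg.one Reg.input) (.block [
    .copy Reg.input Reg.processed, .pop Reg.input,
    .copy Reg.input Reg.processed, .copy Reg.input Reg.entries, .pop Reg.input]),
  .copy Reg.input Reg.processed, .pop Reg.input]

/-- Push `1` on stack `flag` if the content of stack `entries` is the given word. The compared part
of `entries` is removed. -/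
def compareEntries : List ℝ → Prog
  | [] => .cond (.nonempty Reg.entries) .skip (.const Reg.flag 1)
  | r :: p => .cond (.nonempty Reg.entries)
      (.seq (.const Reg.temp r) (ifEq Reg.entries Reg.temp
        (.seq (.block [.pop Reg.temp, .pop Reg.entries]) (compareEntries p))
        (.pop Reg.temp)))
      .skip

/-- Write the current constraint, which is on stack `processed`, on stack `query`. -/
def copyItem : Prog :=
  .block [.clear Reg.indices, .move Reg.processed Reg.query, .const Reg.query 1]

/-- Write a copy of the gadget for every power of two that is at most the top of `bound`. -/
def gadgetLoop (G : List (Constraint.Applied 5)) : Prog :=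
  .loop (.le Reg.power Reg.bound)
    (.seq (emit (symbolsAll G)) (assign .add Reg.power Reg.power Reg.power))

/-- Write copies of the gadget in place of the current constraint `Implies`. -/
def replaceItem (G : List (Constraint.Applied 5)) : Prog := .seq (.clear Reg.processed) (.seq
  (.block [.pop Reg.flag, .copy Reg.indices Reg.x, .pop Reg.indices,
    .copy Reg.indices Reg.y, .pop Reg.indices,
    .arith .add Reg.z₀ Reg.one Reg.z₁, .arith .add Reg.z₁ Reg.one Reg.z₂, .const Reg.power 1])
  (.seq (gadgetLoop G)
    (.block [.pop Reg.power, .pop Reg.x, .pop Reg.y, .pop Reg.z₁, .pop Reg.z₂])))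

/-- Introduce a new variable. -/
def newVar : Prog := .seq (assign .add Reg.z₀ Reg.one Reg.z₀) (.const Reg.newVars 1)

/-- Read one constraint of the input. Its values are left on stack `entries` in reverse order. -/
def readItem : Prog :=
  .block [.pop Reg.input, readNums, .move Reg.entries Reg.indices, readNums]

/-- Handle one constraint of the input. -/
def item (G : List (Constraint.Applied 5)) : Prog := .block [
  readItem, compareEntries [1, 0, 1, 1], .clear Reg.entries,
  .cond (.nonempty Reg.flag) (replaceItem G) copyItem,
  newVar, newVar, newVar]

/-- Handle all constraints of the input. -/
def items (G : List (Constraint.Applied 5)) : Prog := .loop (.le Reg.one Reg.input) (item G)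

/-- Move the word on stack `input` to stack `processed`, and multiply the top of `bound` by its
positive entries, or by their inverses if these are larger. The empty stack `output` provides the
constant `0`. -/
def scan : Prog := .loop (.nonempty Reg.input) (.block [
  .copy Reg.input Reg.processed,
  .cond (.le Reg.input Reg.output) .skip
    (.cond (.le Reg.input Reg.one) (assign .div Reg.bound Reg.input Reg.bound)
      (assign .mul Reg.bound Reg.input Reg.bound)),
  .pop Reg.input])

/-- Read the number of variables of the instance, which is written in unary. -/
def readVars : Prog := .loop (.le Reg.one Reg.input)
  (.block [newVar, .const Reg.vars 1, .pop Reg.input])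

/-- Read the error parameter, and compute the number that determines how many copies of the gadget
are used. -/
def readBound : Prog := .block [
  .block [.copy Reg.input Reg.eps, .pop Reg.input, .const Reg.one 1, .const Reg.bound 2],
  scan,
  .move Reg.processed Reg.input,
  .block [assign .mul Reg.bound Reg.bound Reg.bound, .const Reg.z₀ 0]]

/-- The program up to the oracle call. -/
def prepareQuery (G : List (Constraint.Applied 5)) : Prog := .block [
  readBound,
  readVars,
  .block [.pop Reg.input, .const Reg.query 0],
  items G,
  .const Reg.query 0, .move Reg.newVars Reg.query, .copy Reg.eps Reg.query]

/-- The program after the oracle call: the first entries of the answer are the output. -/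
def restrictAnswer : Prog := .seq
  (.loop (.nonempty Reg.vars)
    (.block [.copy Reg.answer Reg.processed, .pop Reg.answer, .pop Reg.vars]))
  (.move Reg.processed Reg.output)

/-- The reduction with gadget `G`. -/
def program (G : List (Constraint.Applied 5)) : Prog :=
  (prepareQuery G).withCall restrictAnswer

/-! ### The effect of the program -/

/-- Apply a constraint on five variables to the variables `i`, `j`, `c`, `c + 1`, `c + 2`. -/
def localize (i j c : ℕ) (a : Constraint.Applied 5) : RawApplied :=
  ⟨a.con, fun k => ![i, j, c, c + 1, c + 1 + 1] (a.scope k)⟩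

open scoped Classical in
/-- The constraints that replace the constraint `a`: copies of the gadget with new variables from
`c` on if `a` is an application of `Implies`, and otherwise `a` itself. -/
noncomputable def replacement (G : List (Constraint.Applied 5)) (m : ℕ) (a : RawApplied) (c : ℕ) :
    List RawApplied :=
  if a.con = Constraint.implies then
    (List.replicate m (G.map (localize (a.index 0) (a.index 1) c))).flatten
  else [a]

/-- Replace every constraint `Implies` by `m` copies of the gadget `G`. Three new variables are
reserved for every constraint, whether they are needed or not. -/
noncomputable def transform (G : List (Constraint.Applied 5)) (m : ℕ) :
    List RawApplied → ℕ → List RawApplied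
  | [], _ => []
  | a :: L, c => transform G m L (c + 3) ++ replacement G m a c

/-- The larger of a positive number and its inverse; the other numbers have magnitude `1`. -/
noncomputable def magnitude (r : ℝ) : ℝ≥0 := max 1 (max r.toNNReal r.toNNReal⁻¹)

/-- The product of the magnitudes of the entries of a word. On an instance, it bounds the measure
of every solution, and the inverse of every nonzero measure. -/
noncomputable def bound (w : List ℝ) : ℝ≥0 := (w.map magnitude).prod

theorem bound_cons (r : ℝ) (w : List ℝ) : bound (r :: w) = magnitude r * bound w := by
  simp [bound]

theorem magnitude_one : magnitude 1 = 1 := by simp [magnitude]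

theorem magnitude_of_nonpos {r : ℝ} (h : r ≤ 0) : (magnitude r : ℝ) = 1 := by
  simp [magnitude, Real.toNNReal_of_nonpos h]

theorem magnitude_of_le_one {r : ℝ} (h₀ : 0 < r) (h₁ : r ≤ 1) : (magnitude r : ℝ) = r⁻¹ := by
  have : 1 ≤ r⁻¹ := (one_le_inv₀ h₀).2 h₁
  simp [magnitude, h₀.le, h₁.trans this, this]

theorem magnitude_of_one_le {r : ℝ} (h : 1 ≤ r) : (magnitude r : ℝ) = r := by
  have : r⁻¹ ≤ 1 := inv_le_one_of_one_le₀ h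
  simp [magnitude, zero_le_one.trans h, this.trans h, h]

/-- The value of a symbol. -/
noncomputable def symVal (i j c₀ c₁ c₂ : ℝ) : Sym → ℝ := Sum.elim id ![i, j, c₀, c₁, c₂]

theorem map_symVal_symbols (a : Constraint.Applied 5) (i j c : ℕ) :
    (symbols a).map (symVal i j c (c + 1) (c + 1 + 1)) = (localize i j c a).enc := by
  have inr (v : Fin 5) : symVal i j c (c + 1) (c + 1 + 1) (.inr v) =
      ((![i, j, c, c + 1, c + 1 + 1] v : ℕ) : ℝ) := by fin_cases v <;> simp [symVal]
  have inl (r : ℝ) : symVal i j c (c + 1) (c + 1 + 1) (.inl r) = r := rfl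
  simp only [symbols, List.map_append, List.map_flatMap, List.map_cons, List.map_nil, inl, inr,
    RawApplied.enc, encNums_eq_flatMap, RawApplied.indices, RawApplied.values, localize,
    List.append_assoc, List.cons_append, List.nil_append]
  congr 1
  · rw [← Function.comp_def Nat.cast, ← Function.comp_def _ a.scope, ← List.map_ofFn,
      ← List.map_ofFn, List.flatMap_map, List.flatMap_map]
  · rw [List.flatMap_map]

theorem map_symVal_symbolsAll (G : List (Constraint.Applied 5)) (i j c : ℕ) :
    (symbolsAll G).map (symVal i j c (c + 1) (c + 1 + 1)) =
      RawApplied.encAll (G.map (localize i j c)) := by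
  simp only [symbolsAll, RawApplied.encAll, List.map_flatMap, List.map_cons, map_symVal_symbols,
    List.flatMap_map]
  rfl

theorem encAll_flatten_replicate (m : ℕ) (l : List RawApplied) :
    RawApplied.encAll (.flatten (.replicate m l)) =
      .flatten (.replicate m (RawApplied.encAll l)) := by
  induction m with
  | zero => rfl
  | succ m ih => simpa [List.replicate_succ, RawApplied.encAll] using ih

end Reduction

namespace Reduction

open RawApplied

/-! ### Correctness of the parts of the program -/

theorem runs_emit (ys : List Sym) (S : Store) :
    Runs (emit ys) S
      { S with query := ys.map (symVal (S.x.headD 0) (S.y.headD 0) (S.z₀.headD 0) (S.z₁.headD 0)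
        (S.z₂.headD 0)) ++ S.query } (2 * ys.length + 1) := by
  induction ys with
  | nil => exact Runs.straight rfl rfl
  | cons y ys ih =>
    rcases y with r | v
    · exact ih.seq (Runs.straight (c := .const _ r) rfl rfl)
    · refine ih.seq (l := 1) ?_
      fin_cases v <;> exact Runs.straight (c := .copy _ _) rfl rfl

theorem runs_ifEq_pos {s t k : ℕ} {c d : Prog} {S T : Store} (h : S.mem.top s = S.mem.top t)
    (hc : Runs c S T k) : Runs (ifEq s t c d) S T (k + 2) :=
  .cond_pos (b := .le s t) h.le (.cond_pos (b := .le t s) h.ge hc)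

theorem runs_ifEq_neg {s t k : ℕ} {c d : Prog} {S T : Store} (h : S.mem.top s ≠ S.mem.top t)
    (hd : Runs d S T k) : Runs (ifEq s t c d) S T (k + 2) := by
  by_cases hle : S.mem.top s ≤ S.mem.top t
  · exact .cond_pos (b := .le s t) hle (.cond_neg (b := .le t s) (fun h' => h (hle.antisymm h')) hd)
  · exact Runs.mono (.cond_neg (b := .le s t) hle hd) (by omega)

theorem runs_readNums (l R : List ℝ) (S : Store) :
    Runs readNums { S with input := encNums l ++ R, one := [1] }
      { S with
        input := R, one := [1], processed := (encNums l).reverse ++ S.processed,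
        entries := l.reverse ++ S.entries } (10 * l.length + 5) := by
  have hread : Runs (.loop (.le Reg.one Reg.input) (.block [
      .copy Reg.input Reg.processed, .pop Reg.input,
      .copy Reg.input Reg.processed, .copy Reg.input Reg.entries, .pop Reg.input]))
      { S with input := encNums l ++ R, one := [1] }
      { S with
        input := 0 :: R, one := [1],
        processed := (l.flatMap fun r => [1, r]).reverse ++ S.processed,
        entries := l.reverse ++ S.entries } (10 * l.length + 1) := by
    induction l generalizing S with
    | nil => exact Runs.loop_done (show ¬ (1 : ℝ) ≤ 0 by norm_num)
    | cons r l ih =>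
      have hrest := ih { S with processed := r :: 1 :: S.processed, entries := r :: S.entries }
      simp only [List.flatMap_cons, List.reverse_cons, List.append_assoc, List.nil_append,
        List.cons_append]
      refine Runs.mono (.loop_step (show (1 : ℝ) ≤ 1 from le_rfl) (.straight rfl rfl) hrest) ?_
      simp only [Prog.block, Prog.cost, List.length_cons]
      omega
  refine hread.seq (l := 3) ?_
  rw [encNums_eq_flatMap, List.reverse_append]
  exact Runs.straight rfl rfl

theorem runs_compareEntries (p w : List ℝ) (S : Store) : ∃ w' : List ℝ, w'.length ≤ w.length ∧
    Runs (compareEntries p) { S with entries := w, temp := [], flag := [] }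
      { S with entries := w', temp := [], flag := if w = p then [1] else [] }
      (9 * p.length + 4) := by
  induction p generalizing w with
  | nil =>
    cases w with
    | nil =>
      refine ⟨[], le_rfl, ?_⟩
      rw [if_pos rfl]
      exact Runs.mono (.cond_neg (not_not.2 rfl) (.straight rfl rfl)) (by simp [Prog.cost])
    | cons r w =>
      exact ⟨r :: w, le_rfl, Runs.mono (.cond_pos (List.cons_ne_nil r w) (.straight rfl rfl))
        (by simp [Prog.cost])⟩
  | cons r p ih =>
    cases w with
    | nil =>
      exact ⟨[], le_rfl, Runs.mono (.cond_neg (not_not.2 rfl) (.straight rfl rfl))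
        (by simp [Prog.cost])⟩
    | cons r' w =>
      have hconst : Runs (.const Reg.temp r) { S with entries := r' :: w, temp := [], flag := [] }
          { S with entries := r' :: w, temp := [r], flag := [] } 1 := Runs.straight rfl rfl
      obtain rfl | hne := eq_or_ne r' r
      · obtain ⟨w', hw', hrest⟩ := ih w
        refine ⟨w', hw'.trans (Nat.le_succ _), ?_⟩
        simp only [List.cons.injEq, true_and]
        refine Runs.mono (.cond_pos (List.cons_ne_nil r' w) (.seq hconst (runs_ifEq_pos rfl
          (.seq (.straight rfl rfl) hrest)))) ?_
        simp only [Prog.block, Prog.cost, List.length_cons]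
        omega
      · refine ⟨r' :: w, le_rfl, ?_⟩
        rw [if_neg (by simp [hne])]
        exact Runs.mono (.cond_pos (List.cons_ne_nil r' w) (.seq hconst (runs_ifEq_neg hne
          (.straight rfl rfl)))) (by simp [Prog.cost]; omega)

theorem runs_gadgetLoop (G : List (Constraint.Applied 5)) {b : ℝ} (m : ℕ) (P : ℝ)
    (hm : ∀ k, P * 2 ^ k ≤ b ↔ k < m) (S : Store) :
    Runs (gadgetLoop G) { S with bound := [b], power := [P], temp := [] }
      { S with
        bound := [b], power := [P * 2 ^ m], temp := [],
        query := (List.replicate m ((symbolsAll G).map (symVal (S.x.headD 0) (S.y.headD 0)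
          (S.z₀.headD 0) (S.z₁.headD 0) (S.z₂.headD 0)))).flatten ++ S.query }
      (m * (2 * (symbolsAll G).length + 10) + 1) := by
  induction m generalizing P S with
  | zero =>
    rw [pow_zero, mul_one]
    exact Runs.mono (.loop_done (show ¬ P ≤ b by simpa using hm 0)) (by omega)
  | succ m ih =>
    have hrest := ih (P + P) (fun k => by
        rw [← Nat.succ_lt_succ_iff, ← hm, pow_succ, ← two_mul, mul_comm 2 P, mul_assoc,
          mul_comm 2])
      { S with query := (symbolsAll G).map (symVal (S.x.headD 0) (S.y.headD 0) (S.z₀.headD 0)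
          (S.z₁.headD 0) (S.z₂.headD 0)) ++ S.query }
    rw [← two_mul, mul_comm 2 P, mul_assoc, ← pow_succ'] at hrest
    simp only [List.replicate_succ', List.flatten_append, List.flatten_singleton,
      List.append_assoc]
    refine Runs.mono (.loop_step (show P ≤ b by simpa using hm 0)
      (.seq (runs_emit _ _) (.straight rfl (by rw [mul_two]; rfl))) hrest) ?_
    simp only [assign, Prog.block, Prog.cost]
    ring_nf
    omega

/-- The store of the reduction with error parameter `ε`, on an instance with `n` variables, when `c`
variables are in use. -/
def state (ε b : ℝ) (n c : ℕ) (input query : List ℝ) : Store where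
  input := input
  eps := [ε]
  bound := [b]
  one := [1]
  newVars := .replicate c 1
  vars := .replicate n 1
  query := query
  z₀ := [(c : ℝ)]

variable {ε b : ℝ} {n c m : ℕ} {R Q : List ℝ} {G : List (Constraint.Applied 5)}

theorem runs_copyItem (A I : List ℝ) :
    Runs copyItem { state ε b n c R Q with processed := A.reverse, indices := I }
      (state ε b n c R (1 :: A ++ Q)) (2 * I.length + 4 * A.length + 5) := by
  refine Runs.mono (.seq (.clear (T := { state ε b n c R Q with processed := A.reverse })
    (w := I) rfl rfl rfl) (.seq (.move (T := state ε b n c R (A ++ Q)) (w := A.reverse)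
      (by decide) rfl rfl rfl (by simp [Store.toList, state])) (.straight rfl rfl))) ?_
  simp only [Prog.block, Prog.cost, List.length_reverse]
  omega

theorem runs_replaceItem (hm : ∀ k, 2 ^ k ≤ b ↔ k < m) (A : List ℝ) (i j : ℕ) :
    Runs (replaceItem G)
      { state ε b n c R Q with processed := A, indices := [(i : ℝ), (j : ℝ)], flag := [1] }
      (state ε b n c R (encAll (.flatten (.replicate m (G.map (localize i j c)))) ++ Q))
      (2 * A.length + m * (2 * (symbolsAll G).length + 10) + 30) := by
  have hloop := runs_gadgetLoop G m 1 (by simpa using hm)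
    { state ε b n c R Q with
      x := [(i : ℝ)], y := [(j : ℝ)], z₁ := [(c + 1 : ℝ)], z₂ := [(c + 1 + 1 : ℝ)] }
  change Runs _ _ { state ε b n c R (List.flatten (List.replicate m ((symbolsAll G).map
    (symVal i j c (c + 1) (c + 1 + 1)))) ++ Q) with
      x := [(i : ℝ)], y := [(j : ℝ)], z₁ := [(c + 1 : ℝ)], z₂ := [(c + 1 + 1 : ℝ)],
      power := [1 * 2 ^ m] } _ at hloop
  rw [map_symVal_symbolsAll, ← encAll_flatten_replicate] at hloop
  refine Runs.mono (.seq (.clear (T := { state ε b n c R Q with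
    indices := [(i : ℝ), (j : ℝ)], flag := [1] }) (w := A) rfl rfl rfl)
    (.seq (.straight rfl rfl) (.seq hloop (.straight rfl rfl)))) ?_
  simp only [Prog.block, Prog.cost]
  omega

theorem runs_newVar (S : Store) (c : ℝ) :
    Runs newVar { S with z₀ := [c], one := [1], temp := [] }
      { S with z₀ := [c + 1], one := [1], temp := [], newVars := 1 :: S.newVars } 9 :=
  Runs.straight rfl rfl

theorem runs_newVar_state :
    Runs newVar (state ε b n c R Q) (state ε b n (c + 1) R Q) 9 := by
  have := runs_newVar (state ε b n c R Q) c
  rwa [← Nat.cast_succ] at this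

theorem runs_replacement (hm : ∀ k, 2 ^ k ≤ b ↔ k < m) (a : RawApplied) {F : List ℝ}
    (hF : F = [1] ∧ a.con = Constraint.implies ∨ F = [] ∧ a.con ≠ Constraint.implies) :
    Runs (.cond (.nonempty Reg.flag) (replaceItem G) copyItem)
      { state ε b n c R Q with processed := a.enc.reverse, indices := a.indices, flag := F }
      (state ε b n c R (encAll (replacement G m a c) ++ Q))
      (6 * a.enc.length + m * (2 * (symbolsAll G).length + 10) + 31) := by
  have hlen := a.length_enc
  obtain ⟨rfl, ha⟩ | ⟨rfl, ha⟩ := hF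
  · rw [replacement, if_pos ha, indices_of_implies ha]
    refine Runs.mono (.cond_pos (List.cons_ne_nil (1 : ℝ) []) (runs_replaceItem hm _ _ _)) ?_
    rw [List.length_reverse]
    omega
  · rw [replacement, if_neg ha, encAll, List.flatMap_singleton]
    exact Runs.mono (.cond_neg (not_not.2 rfl) (runs_copyItem a.enc a.indices)) (by omega)

theorem runs_readItem (a : RawApplied) :
    Runs readItem (state ε b n c (1 :: (a.enc ++ R)) Q)
      { state ε b n c R Q with
        processed := a.enc.reverse, indices := a.indices, entries := a.values.reverse }
      (10 * a.enc.length + 20) := by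
  have hpop : Runs (.pop Reg.input) (state ε b n c (1 :: (a.enc ++ R)) Q)
      (state ε b n c (encNums a.indices ++ (encNums a.values ++ R)) Q) 1 := by
    rw [enc, List.append_assoc]
    exact Runs.straight rfl rfl
  have hindices := runs_readNums a.indices (encNums a.values ++ R) (state ε b n c [] Q)
  have hmove : Runs (.move Reg.entries Reg.indices)
      { state ε b n c (encNums a.values ++ R) Q with
        processed := (encNums a.indices).reverse ++ [], entries := a.indices.reverse ++ [] }
      { state ε b n c (encNums a.values ++ R) Q with
        processed := (encNums a.indices).reverse, indices := a.indices }
      (4 * a.indices.reverse.length + 1) :=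
    Runs.move (by decide) rfl rfl (List.append_nil _) (by simp [Store.toList, state])
  have hvalues := runs_readNums a.values R { state ε b n c [] Q with
    processed := (encNums a.indices).reverse, indices := a.indices }
  simp only [state, ← List.reverse_append, List.append_nil] at hvalues
  refine Runs.mono (.seq hpop (.seq hindices (.seq hmove hvalues))) ?_
  rw [a.length_enc, List.length_reverse]
  omega

theorem runs_item (hm : ∀ k, 2 ^ k ≤ b ↔ k < m) (a : RawApplied) :
    Runs (item G) (state ε b n c (1 :: (a.enc ++ R)) Q)
      (state ε b n (c + 3) R (encAll (replacement G m a c) ++ Q))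
      (20 * a.enc.length + m * (2 * (symbolsAll G).length + 10) + 200) := by
  obtain ⟨w, hw, hcompare⟩ := runs_compareEntries [1, 0, 1, 1] a.values.reverse
    { state ε b n c R Q with processed := a.enc.reverse, indices := a.indices }
  have hreplace := runs_replacement (G := G) (ε := ε) (n := n) (c := c) (R := R) (Q := Q) hm a
    (F := if a.values.reverse = [1, 0, 1, 1] then [1] else []) (by
      have hvalues : a.values.reverse = [1, 0, 1, 1] ↔ a.con = Constraint.implies :=
        List.reverse_eq_iff.trans a.values_eq_iff
      split_ifs with h
      · exact .inl ⟨rfl, hvalues.1 h⟩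
      · exact .inr ⟨rfl, mt hvalues.2 h⟩)
  refine Runs.mono (.seq (runs_readItem a) (.seq hcompare (.seq (.clear (w := w) rfl rfl rfl)
    (.seq hreplace (.seq runs_newVar_state (.seq runs_newVar_state runs_newVar_state)))))) ?_
  have hlen := a.length_enc
  simp only [List.length_reverse, List.length_cons, List.length_nil] at hw ⊢
  omega

theorem runs_items (hm : ∀ k, 2 ^ k ≤ b ↔ k < m) (L : List RawApplied) :
    Runs (items G) (state ε b n c (encAll L ++ [0]) Q)
      (state ε b n (c + 3 * L.length) [0] (encAll (transform G m L c) ++ Q))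
      (20 * (encAll L).length + L.length * (m * (2 * (symbolsAll G).length + 10) + 201) + 1) := by
  induction L generalizing c Q with
  | nil => exact Runs.mono (.loop_done (show ¬ (1 : ℝ) ≤ 0 by norm_num)) (by omega)
  | cons a L ih =>
    have hitem := runs_item (G := G) (ε := ε) (n := n) (c := c) (Q := Q) (R := encAll L ++ [0]) hm a
    have hrest := ih (c := c + 3) (Q := encAll (replacement G m a c) ++ Q)
    have henc : encAll (a :: L) = 1 :: (a.enc ++ encAll L) := rfl
    have htransform : encAll (transform G m (a :: L) c) =
      encAll (transform G m L (c + 3)) ++ encAll (replacement G m a c) := List.flatMap_append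
    rw [← List.append_assoc, ← htransform,
      show c + 3 + 3 * L.length = c + 3 * (a :: L).length by simp; ring] at hrest
    rw [henc, List.cons_append, List.append_assoc]
    refine Runs.mono (.loop_step (show (1 : ℝ) ≤ 1 from le_rfl) hitem hrest) ?_
    simp only [List.length_cons, List.length_append, add_mul]
    omega

theorem runs_scan (w A : List ℝ) (b : ℝ) :
    Runs scan { input := w, processed := A, one := [1], bound := [b], eps := [ε] }
      { processed := w.reverse ++ A, one := [1], bound := [b * bound w], eps := [ε] }
      (20 * w.length + 1) := by
  induction w generalizing A b with
  | nil =>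
    rw [show b * (bound [] : ℝ) = b by simp [bound]]
    exact Runs.loop_done (not_not.2 rfl)
  | cons r w ih =>
    have hrest := ih (r :: A) (b * magnitude r)
    rw [mul_assoc, ← NNReal.coe_mul, ← bound_cons, List.append_cons, ← List.reverse_cons] at hrest
    have hmul : Runs (.cond (.le Reg.input Reg.output) .skip
        (.cond (.le Reg.input Reg.one) (assign .div Reg.bound Reg.input Reg.bound)
          (assign .mul Reg.bound Reg.input Reg.bound)))
        { input := r :: w, processed := r :: A, one := [1], bound := [b], eps := [ε] }
        { input := r :: w, processed := r :: A, one := [1], bound := [b * magnitude r], eps := [ε] }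
        9 := by
      obtain h₀ | h₀ := le_or_gt r 0
      · rw [magnitude_of_nonpos h₀, mul_one]
        exact Runs.mono (.cond_pos h₀ (.straight rfl rfl)) (by decide)
      obtain h₁ | h₁ := le_or_gt r 1
      · rw [magnitude_of_le_one h₀ h₁]
        exact .cond_neg h₀.not_ge (.cond_pos h₁ (.straight rfl rfl))
      · rw [magnitude_of_one_le h₁.le]
        exact .cond_neg h₀.not_ge (.cond_neg h₁.not_ge (.straight rfl rfl))
    refine Runs.mono (.loop_step (List.cons_ne_nil r w)
      (.seq (.straight rfl rfl) (.seq hmul (.straight rfl rfl))) hrest) ?_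
    simp only [Prog.block, Prog.cost, List.length_cons]
    omega

theorem runs_readVars (k : ℕ) :
    Runs readVars (state ε b c c (.replicate k 1 ++ 0 :: R) [])
      (state ε b (c + k) (c + k) (0 :: R) []) (20 * k + 1) := by
  induction k generalizing c with
  | zero => exact Runs.loop_done (show ¬ (1 : ℝ) ≤ 0 by norm_num)
  | succ k ih =>
    have hrest := ih (c := c + 1)
    rw [add_assoc, add_comm 1 k] at hrest
    refine Runs.mono (.loop_step (show (1 : ℝ) ≤ 1 from le_rfl)
      (.seq (runs_newVar_state (R := .replicate (k + 1) 1 ++ 0 :: R)) (.straight rfl rfl)) hrest) ?_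
    simp only [Prog.block, Prog.cost]
    omega

theorem runs_readBound (W : List ℝ) :
    Runs readBound { input := ε :: W } (state ε (2 * bound W * (2 * bound W)) 0 0 W [])
      (24 * W.length + 30) := by
  have hscan := runs_scan (ε := ε) W [] 2
  rw [List.append_nil] at hscan
  have hback : Runs (.move Reg.processed Reg.input)
      { processed := W.reverse, one := [1], bound := [2 * bound W], eps := [ε] }
      { input := W, one := [1], bound := [2 * bound W], eps := [ε] }
      (4 * W.reverse.length + 1) :=
    Runs.move (by decide) rfl rfl rfl (by simp [Store.toList])
  have hsquare : Runs (.block [assign .mul Reg.bound Reg.bound Reg.bound, .const Reg.z₀ 0])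
      { input := W, one := [1], bound := [2 * bound W], eps := [ε] }
      (state ε (2 * bound W * (2 * bound W)) 0 0 W []) 9 := by
    rw [state, Nat.cast_zero]
    exact Runs.straight rfl rfl
  refine Runs.mono (.seq (.straight rfl rfl) (.seq hscan (.seq hback hsquare))) ?_
  simp only [Prog.block, Prog.cost, List.length_reverse]
  omega

theorem runs_prepareQuery {L : List RawApplied} {W : List ℝ}
    (hW : W = encList (.replicate n []) ++ encList (L.map enc))
    (hm : ∀ k, (2 : ℝ) ^ k ≤ 2 * bound W * (2 * bound W) ↔ k < m) :
    Runs (prepareQuery G) { input := ε :: W }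
      { state ε (2 * bound W * (2 * bound W)) n (n + 3 * L.length) [0]
          (ε :: (encList (.replicate (n + 3 * L.length) []) ++
            encList ((transform G m L n).map enc))) with newVars := [] }
      (W.length * (m * (2 * (symbolsAll G).length + 10) + 300)) := by
  simp only [encList_replicate_nil, encList_map_enc] at hW ⊢
  have hbound := runs_readBound (ε := ε) W
  generalize (2 * bound W * (2 * bound W) : ℝ) = b at hm hbound ⊢
  have hvars := runs_readVars (ε := ε) (b := b) (c := 0) (R := encAll L ++ [0]) n
  rw [zero_add, List.append_cons, ← hW] at hvars
  have hitems := runs_items (G := G) (ε := ε) (n := n) (c := n) (Q := [0]) hm L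
  generalize encAll (transform G m L n) = T at hitems ⊢
  generalize hn' : n + 3 * L.length = n' at hitems ⊢
  have hmove : Runs (.move Reg.newVars Reg.query)
      (state ε b n n' [0] (0 :: (T ++ [0])))
      { state ε b n n' [0] (.replicate n' 1 ++ 0 :: (T ++ [0])) with newVars := [] }
      (4 * (List.replicate n' (1 : ℝ)).length + 1) :=
    Runs.move (by decide) rfl rfl rfl (by simp [Store.toList, state])
  refine Runs.mono (.seq hbound (.seq hvars (.seq (.straight rfl rfl) (.seq hitems
    (.seq (.straight (c := .const Reg.query 0) rfl rfl)
      (.seq hmove (.straight (c := .copy Reg.eps Reg.query) rfl (by simp; rfl)))))))) ?_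
  have hlen : W.length = n + (encAll L).length + 2 := by simp [hW]; omega
  have hL := length_le_length_encAll L
  have hcost := Nat.mul_le_mul_right (m * (2 * (symbolsAll G).length + 10))
    (show L.length ≤ W.length by omega)
  simp only [Prog.block, Prog.cost, List.length_replicate, mul_add] at hcost ⊢
  omega

theorem runs_restrictAnswer (w : List ℝ) (S : Store) (n : ℕ) :
    Runs restrictAnswer
      { S with vars := .replicate n 1, answer := w, processed := [], output := [] }
      { S with vars := [], answer := w.drop n, processed := [],
               output := List.ofFn fun i : Fin n => w.getD i 0 } (12 * n + 3) := by
  have hcopy (A : List ℝ) : Runs (.loop (.nonempty Reg.vars)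
      (.block [.copy Reg.answer Reg.processed, .pop Reg.answer, .pop Reg.vars]))
      { S with vars := .replicate n 1, answer := w, processed := A, output := [] }
      { S with vars := [], answer := w.drop n, output := [],
               processed := (List.ofFn fun i : Fin n => w.getD i 0).reverse ++ A }
      (6 * n + 1) := by
    induction n generalizing w A with
    | zero => exact Runs.loop_done (not_not.2 rfl)
    | succ n ih =>
      have hrest := ih w.tail (w.headD 0 :: A)
      have hlist : List.ofFn (fun i : Fin (n + 1) => w.getD i 0) =
          w.headD 0 :: List.ofFn fun i : Fin n => w.tail.getD i 0 := by
        rw [List.ofFn_succ]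
        cases w <;> rfl
      have hdrop : w.drop (n + 1) = w.tail.drop n := by cases w <;> simp
      rw [hlist, hdrop, List.reverse_cons, List.append_assoc, List.singleton_append]
      refine Runs.mono (.loop_step (List.cons_ne_nil 1 _) (.straight rfl rfl) hrest) ?_
      simp only [Prog.block, Prog.cost]
      omega
  have hmove : Runs (.move Reg.processed Reg.output)
      { S with vars := [], answer := w.drop n, output := [],
               processed := (List.ofFn fun i : Fin n => w.getD i 0).reverse ++ [] }
      { S with vars := [], answer := w.drop n, processed := [],
               output := List.ofFn fun i : Fin n => w.getD i 0 }
      (4 * (List.ofFn fun i : Fin n => w.getD i 0).reverse.length + 1) :=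
    Runs.move (by decide) rfl rfl (List.append_nil _) (by simp [Store.toList])
  refine Runs.mono (.seq (hcopy []) hmove) ?_
  rw [List.length_reverse, List.length_ofFn]
  omega

end Reduction

namespace Reduction

open Constraint

/-! ### Correctness of the replacement -/

namespace RawApplied

/-- The value of an applied constraint at an assignment of all variables. -/
noncomputable def eval (τ : ℕ → Bool) (a : RawApplied) : ℝ≥0 := a.con.val fun k => τ (a.scope k)

/-- The applied constraint is `Implies`, and the assignment does not satisfy it. -/
def Violated (τ : ℕ → Bool) (a : RawApplied) : Prop :=
  a.con = implies ∧ τ (a.index 0) = true ∧ τ (a.index 1) = false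

open scoped Classical in
theorem eval_of_implies {a : RawApplied} (h : a.con = implies) (τ : ℕ → Bool) :
    a.eval τ = if a.Violated τ then 0 else 1 := by
  obtain ⟨i, j, rfl⟩ := exists_eq_implies h
  have hV : Violated τ ⟨implies, ![i, j]⟩ ↔ τ i = true ∧ τ j = false := by
    simp [Violated, index, implies]
  simp only [hV]
  rfl

theorem index_lt_of_implies {a : RawApplied} (h : a.con = implies) {c : ℕ}
    (hc : ∀ k, a.scope k < c) : a.index 0 < c ∧ a.index 1 < c := by
  obtain ⟨i, j, rfl⟩ := exists_eq_implies h
  simpa [index, implies] using And.intro (hc (0 : Fin 2)) (hc (1 : Fin 2))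

theorem Violated.congr {a : RawApplied} {c : ℕ} (hc : ∀ k, a.scope k < c) {τ τ' : ℕ → Bool}
    (h : ∀ k < c, τ' k = τ k) (ha : a.Violated τ') : a.Violated τ := by
  obtain ⟨h₀, h₁⟩ := index_lt_of_implies ha.1 hc
  exact ⟨ha.1, h _ h₀ ▸ ha.2.1, h _ h₁ ▸ ha.2.2⟩

open scoped Classical in
/-- The value of an applied constraint, where `Implies` is relaxed to `(1, 1, 2 ^ (-m), 1)`. -/
noncomputable def relaxed (m : ℕ) (τ : ℕ → Bool) (a : RawApplied) : ℝ≥0 :=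
  if a.Violated τ then (1 / 2) ^ m else a.eval τ

end RawApplied

open RawApplied

/-- The product of a list of applied constraints at an assignment of all variables. -/
noncomputable def prodRaw (L : List RawApplied) (τ : ℕ → Bool) : ℝ≥0 := (L.map (eval τ)).prod

section Replacement

variable {f : Constraint} {G : List (Applied 5)} {F : Set Constraint} {m c : ℕ}
  {a b : RawApplied} {L L' : List RawApplied} {τ τ' : ℕ → Bool}

theorem prodRaw_append : prodRaw (L ++ L') τ = prodRaw L τ * prodRaw L' τ := by simp [prodRaw]

theorem prodRaw_flatten_replicate : prodRaw (List.replicate m L).flatten τ = prodRaw L τ ^ m := by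
  simp [prodRaw, List.map_flatten, List.prod_flatten]

theorem prodRaw_congr (hL : ∀ a ∈ L, ∀ k, a.scope k < c) (h : ∀ k < c, τ' k = τ k) :
    prodRaw L τ' = prodRaw L τ :=
  congrArg List.prod <| List.map_congr_left fun a ha =>
    congrArg a.con.val <| funext fun k => h _ (hL a ha k)

theorem prodRaw_map_localize (i j : ℕ) : prodRaw (G.map (localize i j c)) τ =
    prodEval G ![τ i, τ j, τ c, τ (c + 1), τ (c + 1 + 1)] := by
  have h (v : Fin 5) : τ (![i, j, c, c + 1, c + 1 + 1] v) =
      ![τ i, τ j, τ c, τ (c + 1), τ (c + 1 + 1)] v := by fin_cases v <;> rfl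
  simp only [prodRaw, prodEval, List.map_map, Function.comp_def, eval, localize, Applied.eval, h]

theorem mem_replacement (hb : b ∈ replacement G m a c) :
    (a.con = implies ∧ ∃ g ∈ G, b = localize (a.index 0) (a.index 1) c g) ∨
      (a.con ≠ implies ∧ b = a) := by
  classical
  unfold replacement at hb
  split_ifs at hb with h
  · obtain ⟨l, hl, hbl⟩ := List.mem_flatten.1 hb
    rw [List.eq_of_mem_replicate hl] at hbl
    obtain ⟨g, hg, rfl⟩ := List.mem_map.1 hbl
    exact .inl ⟨h, g, hg, rfl⟩
  · exact .inr ⟨h, List.mem_singleton.1 hb⟩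

theorem scope_lt_of_mem_replacement (ha : ∀ k, a.scope k < c) (hb : b ∈ replacement G m a c)
    (k : Fin b.con.arity) : b.scope k < c + 3 := by
  obtain ⟨h, g, -, rfl⟩ | ⟨-, rfl⟩ := mem_replacement hb
  · obtain ⟨h₀, h₁⟩ := index_lt_of_implies h ha
    simp only [localize]
    generalize g.scope k = v
    fin_cases v <;> simp <;> omega
  · exact (ha k).trans_le (Nat.le_add_right _ _)

theorem scope_lt_of_mem_transform (hL : ∀ a ∈ L, ∀ k, a.scope k < c) (hb : b ∈ transform G m L c)
    (k : Fin b.con.arity) : b.scope k < c + 3 * L.length := by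
  induction L generalizing c with
  | nil => simp [transform] at hb
  | cons a L ih =>
    rw [List.forall_mem_cons] at hL
    rw [List.length_cons]
    rcases List.mem_append.1 hb with hb | hb
    · have := ih (fun a ha k => (hL.2 a ha k).trans_le (Nat.le_add_right c 3)) hb
      omega
    · have := scope_lt_of_mem_replacement hL.1 hb k
      omega

theorem con_mem_of_mem_transform (hG : IsGadget f G)
    (hL : ∀ a ∈ L, a.con ∈ {implies} ∪ F ∪ unary) (hb : b ∈ transform G m L c) :
    b.con ∈ {f} ∪ F ∪ unary := by
  induction L generalizing c with
  | nil => simp [transform] at hb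
  | cons a L ih =>
    rw [List.forall_mem_cons] at hL
    rcases List.mem_append.1 hb with hb | hb
    · exact ih hL.2 hb
    obtain ⟨-, g, hg, rfl⟩ | ⟨h, rfl⟩ := mem_replacement hb
    · exact (hG.mem g hg).imp_left .inl
    · exact hL.1.imp_left fun h' => .inr (h'.resolve_left h)

theorem prodRaw_replacement_le (hG : IsGadget f G) :
    prodRaw (replacement G m a c) τ ≤ a.relaxed m τ := by
  classical
  unfold replacement relaxed
  by_cases h : a.con = implies
  · rw [if_pos h, prodRaw_flatten_replicate, prodRaw_map_localize, eval_of_implies h]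
    split_ifs with hv
    · exact pow_le_pow_left₀ zero_le (hG.le_half _ hv.2.1 hv.2.2) m
    · exact pow_le_one₀ zero_le (hG.le_one _)
  · rw [if_neg h, if_neg fun hv => h hv.1]
    simp [prodRaw]

theorem prodRaw_transform_le (hG : IsGadget f G) :
    prodRaw (transform G m L c) τ ≤ (L.map (relaxed m τ)).prod := by
  induction L generalizing c with
  | nil => simp [transform, prodRaw]
  | cons a L ih =>
    rw [transform, prodRaw_append, List.map_cons, List.prod_cons, mul_comm]
    exact mul_le_mul' (prodRaw_replacement_le hG) ih

theorem prod_relaxed_of_not_violated (h : ∀ a ∈ L, ¬ a.Violated τ) :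
    (L.map (relaxed m τ)).prod = prodRaw L τ :=
  congrArg List.prod <| List.map_congr_left fun a ha => if_neg (h a ha)

theorem not_violated_of_prodRaw_ne_zero (h : prodRaw L τ ≠ 0) (ha : a ∈ L) :
    ¬ a.Violated τ := by
  classical
  exact fun hv => h <| List.prod_eq_zero <| List.mem_map.2
    ⟨a, ha, (eval_of_implies hv.1 τ).trans (if_pos hv)⟩

theorem exists_prodRaw_replacement (hG : IsGadget f G) (ha : ∀ k, a.scope k < c)
    (hτ : ¬ a.Violated τ) :
    ∃ τ' : ℕ → Bool, (∀ k < c, τ' k = τ k) ∧ prodRaw (replacement G m a c) τ' = a.eval τ := by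
  classical
  by_cases h : a.con = implies
  · obtain ⟨h₀, h₁⟩ := index_lt_of_implies h ha
    obtain ⟨z₀, z₁, z₂, hz⟩ := hG.eq_one (τ (a.index 0)) (τ (a.index 1)) fun hi => by
      simpa using fun hj => hτ ⟨h, hi, hj⟩
    let τ' (k : ℕ) := if k < c then τ k else if k = c then z₀ else if k = c + 1 then z₁ else z₂
    refine ⟨τ', fun k hk => if_pos hk, ?_⟩
    have hnew : τ' c = z₀ ∧ τ' (c + 1) = z₁ ∧ τ' (c + 1 + 1) = z₂ := by
      refine ⟨by simp [τ'], by simp [τ'], ?_⟩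
      simp only [τ', show ¬ c + 1 + 1 < c by omega, show c + 1 + 1 ≠ c by omega,
        show c + 1 + 1 ≠ c + 1 by omega, if_false]
    have hold : τ' (a.index 0) = τ (a.index 0) ∧ τ' (a.index 1) = τ (a.index 1) :=
      ⟨if_pos h₀, if_pos h₁⟩
    rw [replacement, if_pos h, prodRaw_flatten_replicate, prodRaw_map_localize, eval_of_implies h,
      if_neg hτ, hnew.1, hnew.2.1, hnew.2.2, hold.1, hold.2, hz, one_pow]
  · exact ⟨τ, fun _ _ => rfl, by simp [replacement, h, prodRaw]⟩

theorem exists_prodRaw_transform (hG : IsGadget f G) (hL : ∀ a ∈ L, ∀ k, a.scope k < c)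
    (hτ : ∀ a ∈ L, ¬ a.Violated τ) :
    ∃ τ' : ℕ → Bool, (∀ k < c, τ' k = τ k) ∧ prodRaw (transform G m L c) τ' = prodRaw L τ := by
  induction L generalizing c τ with
  | nil => exact ⟨τ, fun _ _ => rfl, rfl⟩
  | cons a L ih =>
    rw [List.forall_mem_cons] at hL hτ
    obtain ⟨τ₁, h₁, ha⟩ := exists_prodRaw_replacement hG (m := m) hL.1 hτ.1
    obtain ⟨τ₂, h₂, hL₂⟩ := ih (fun b hb k => (hL.2 b hb k).trans_le (Nat.le_add_right c 3))
      fun b hb hv => hτ.2 b hb (hv.congr (hL.2 b hb) h₁)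
    refine ⟨τ₂, fun k hk => (h₂ k (by omega)).trans (h₁ k hk), ?_⟩
    rw [transform, prodRaw_append, hL₂, prodRaw_congr hL.2 h₁,
      prodRaw_congr (fun b hb => scope_lt_of_mem_replacement hL.1 hb) h₂, ha, mul_comm]
    simp [prodRaw]

end Replacement

/-! ### Bounds for the values of an instance -/

theorem one_le_magnitude (r : ℝ) : 1 ≤ magnitude r := le_max_left _ _

theorem one_le_bound (w : List ℝ) : 1 ≤ bound w :=
  List.one_le_prod_of_one_le fun _ h => by
    obtain ⟨r, -, rfl⟩ := List.mem_map.1 h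
    exact one_le_magnitude r

theorem bound_append (w w' : List ℝ) : bound (w ++ w') = bound w * bound w' := by simp [bound]

theorem magnitude_le_bound {r : ℝ} {w : List ℝ} (h : r ∈ w) : magnitude r ≤ bound w := by
  obtain ⟨w₁, w₂, rfl⟩ := List.append_of_mem h
  rw [bound_append, bound_cons]
  exact (le_mul_of_one_le_right' (one_le_bound w₂)).trans (le_mul_of_one_le_left' (one_le_bound w₁))

theorem magnitude_le_rpow (r : ℝ) : (magnitude r : ℝ) ≤ 2 ^ (1 + |Real.logb 2 (|r|)|) := by
  have rpow_logb (hr : 0 < r) : (2 : ℝ) ^ Real.logb 2 r = r :=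
    Real.rpow_logb two_pos (by norm_num) hr
  have le_rpow {e : ℝ} (he : e ≤ |Real.logb 2 (|r|)|) :
      (2 : ℝ) ^ e ≤ 2 ^ (1 + |Real.logb 2 (|r|)|) :=
    Real.rpow_le_rpow_of_exponent_le one_le_two (by linarith)
  rcases le_or_gt r 0 with h₀ | h₀
  · rw [magnitude_of_nonpos h₀]
    exact Real.one_le_rpow one_le_two (by positivity)
  rw [abs_of_pos h₀] at le_rpow ⊢
  rcases le_total r 1 with h₁ | h₁
  · rw [magnitude_of_le_one h₀ h₁]
    simpa [Real.rpow_neg, rpow_logb h₀] using le_rpow (neg_le_abs _)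
  · rw [magnitude_of_one_le h₁]
    simpa [rpow_logb h₀] using le_rpow (le_abs_self _)

theorem wordSize_cons (r : ℝ) (w : List ℝ) :
    wordSize (r :: w) = 1 + |Real.logb 2 (|r|)| + wordSize w := by simp [wordSize]

theorem bound_le_rpow_wordSize (w : List ℝ) : (bound w : ℝ) ≤ 2 ^ wordSize w := by
  induction w with
  | nil => simp [bound, wordSize]
  | cons r w ih =>
    rw [bound_cons, wordSize_cons, Real.rpow_add two_pos, NNReal.coe_mul]
    exact mul_le_mul (magnitude_le_rpow r) ih (NNReal.coe_nonneg _) (by positivity)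

theorem length_le_wordSize (w : List ℝ) : (w.length : ℝ) ≤ wordSize w := by
  induction w with
  | nil => simp [wordSize]
  | cons r w ih =>
    rw [wordSize_cons, List.length_cons, Nat.cast_add, Nat.cast_one]
    linarith [abs_nonneg (Real.logb 2 |r|)]

theorem mem_table (k : ℕ) (g : (Fin k → Bool) → ℝ≥0) (x : Fin k → Bool) : g x ∈ table k g := by
  induction k with
  | zero => simp [table, Subsingleton.elim x Fin.elim0]
  | succ k ih =>
    rw [table, List.mem_append, ← Fin.cons_self_tail x]
    cases x 0
    · exact .inl (ih (fun y => g (Fin.cons false y)) _)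
    · exact .inr (ih (fun y => g (Fin.cons true y)) _)

section Bounds

variable {τ τ₀ : ℕ → Bool} {L : List RawApplied} {m : ℕ}

theorem coe_eval_mem_enc (τ : ℕ → Bool) (a : RawApplied) : (a.eval τ : ℝ) ∈ a.enc := by
  have h : (a.eval τ : ℝ) ∈ a.values := List.mem_map_of_mem (mem_table _ _ _)
  rw [enc, List.mem_append, encNums_eq_flatMap a.values]
  exact .inr (List.mem_append_left _ (List.mem_flatMap.2 ⟨_, h, by simp⟩))

theorem max_eval_inv_le_bound (τ : ℕ → Bool) (a : RawApplied) :
    max (a.eval τ) (a.eval τ)⁻¹ ≤ bound a.enc := by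
  refine le_trans ?_ (magnitude_le_bound (coe_eval_mem_enc τ a))
  simp [magnitude]

theorem bound_encAll (L : List RawApplied) :
    bound (encAll L) = (L.map fun a => bound a.enc).prod := by
  induction L with
  | nil => rfl
  | cons a L ih =>
    rw [List.map_cons, List.prod_cons, ← ih, ← one_mul (bound a.enc * _), ← magnitude_one,
      ← bound_append, ← bound_cons]
    rfl

theorem relaxed_le_bound (m : ℕ) (τ : ℕ → Bool) (a : RawApplied) :
    a.relaxed m τ ≤ bound a.enc := by
  unfold relaxed
  split_ifs
  · exact (pow_le_one₀ zero_le (by norm_num)).trans (one_le_bound _)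
  · exact (le_max_left _ _).trans (max_eval_inv_le_bound τ a)

theorem prod_relaxed_le_bound (m : ℕ) (τ : ℕ → Bool) (L : List RawApplied) :
    (L.map (relaxed m τ)).prod ≤ bound (encAll L) := by
  rw [bound_encAll]
  exact List.prod_le_prod' fun a _ => relaxed_le_bound m τ a

theorem prod_relaxed_le_of_violated {a : RawApplied} (ha : a ∈ L) (hv : a.Violated τ) :
    (L.map (relaxed m τ)).prod ≤ (1 / 2) ^ m * bound (encAll L) := by
  obtain ⟨L₁, L₂, rfl⟩ := List.append_of_mem ha
  have h₁ := prod_relaxed_le_bound m τ L₁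
  have h₂ := prod_relaxed_le_bound m τ L₂
  have hrel : a.relaxed m τ = (1 / 2) ^ m := if_pos hv
  simp only [bound_encAll, List.map_append, List.prod_append, List.map_cons, List.prod_cons,
    hrel] at h₁ h₂ ⊢
  rw [mul_left_comm]
  gcongr
  exact h₂.trans (le_mul_of_one_le_left' (one_le_bound _))

theorem inv_prodRaw_le_bound (L : List RawApplied) (τ : ℕ → Bool) :
    (prodRaw L τ)⁻¹ ≤ bound (encAll L) := by
  rw [bound_encAll, prodRaw, List.prod_inv, List.map_map]
  exact List.prod_le_prod' fun a _ => (le_max_right _ _).trans (max_eval_inv_le_bound τ a)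

/-- Violating a constraint `Implies` costs a factor `2 ^ m`, which exceeds the ratio of any two
nonzero measures. -/
theorem prodRaw_transform_le_prodRaw {f : Constraint} {G : List (Applied 5)} (hG : IsGadget f G)
    {c : ℕ} (hm : 2 * bound (encAll L) * (2 * bound (encAll L)) < 2 ^ m)
    (h₀ : prodRaw L τ₀ ≠ 0) (h : prodRaw L τ₀ ≤ 2 * prodRaw (transform G m L c) τ) :
    prodRaw (transform G m L c) τ ≤ prodRaw L τ := by
  suffices hV : ∀ a ∈ L, ¬ a.Violated τ from
    (prodRaw_transform_le hG).trans (prod_relaxed_of_not_violated hV).le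
  intro a ha hv
  set B := bound (encAll L)
  have hB : 0 < B := zero_lt_one.trans_le (one_le_bound _)
  have hinv : B⁻¹ ≤ 2 * ((1 / 2) ^ m * B) := calc
    B⁻¹ ≤ prodRaw L τ₀ := inv_le_of_inv_le₀ (pos_iff_ne_zero.2 h₀) (inv_prodRaw_le_bound L τ₀)
    _ ≤ 2 * prodRaw (transform G m L c) τ := h
    _ ≤ 2 * ((1 / 2) ^ m * B) :=
      mul_le_mul_right ((prodRaw_transform_le hG).trans (prod_relaxed_le_of_violated ha hv)) _
  have hpow : 2 ^ m ≤ 2 * B * B := calc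
    2 ^ m = 2 ^ m * B * B⁻¹ := (mul_inv_cancel_right₀ hB.ne' _).symm
    _ ≤ 2 ^ m * B * (2 * ((1 / 2) ^ m * B)) := mul_le_mul_right hinv _
    _ = (2 ^ m * (1 / 2) ^ m) * (2 * B * B) := by ring
    _ = 2 * B * B := by rw [← mul_pow]; simp
  refine (hm.trans_le hpow).not_ge (mul_le_mul_right ?_ _)
  exact le_mul_of_one_le_left' one_le_two

end Bounds

end Reduction

/-! ### Programs with a single oracle call -/

theorem Store.start_mem (N : Prog) (w : List ℝ) :
    Config.start N w = ⟨[N], ({ input := w } : Store).mem⟩ := by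
  have h : (fun _ => []) = ({} : Store).mem := by
    funext s
    by_cases hs : s < 20
    · interval_cases s <;> rfl
    · exact (List.getD_eq_default _ _ (not_lt.1 hs)).symm
  rw [Config.start, h, Store.mem, Memory.update_ofList (by simp [toList])]
  rfl

theorem Store.update_mem (S : Store) (w : List ℝ) :
    Function.update (Function.update S.mem Reg.query []) Reg.answer w =
      { S with query := [], answer := w }.mem := by
  rw [mem, Memory.update_ofList (by decide : Reg.query < 20),
    Memory.update_ofList (by decide : Reg.answer < 20)]
  rfl

namespace Runs

variable {c d : Prog} {S T : Store} {U : List ℝ → Store} {k l : ℕ}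

theorem run_eq (h : Runs c S T k) (M : Oracle) {t : ℕ} (hkt : k ≤ t) :
    Config.run M t ⟨[c], S.mem⟩ = PMF.pure ⟨[], T.mem⟩ := by
  obtain ⟨s, hs, h⟩ := h
  obtain ⟨r, rfl⟩ := Nat.exists_eq_add_of_le (hs.trans hkt)
  rw [(h.reach M []).run_add, Config.run_halted]

theorem not_calls (h : Runs c S T k) {M : Oracle} {t : ℕ} {C : Config}
    (hC : C ∈ (Config.run M t ⟨[c], S.mem⟩).support) (w : List ℝ) : ¬ C.Calls w := by
  obtain ⟨s, -, h⟩ := h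
  rcases lt_or_ge t s with hts | hts
  · exact (h.reach M []).not_calls hts hC w
  · obtain ⟨r, rfl⟩ := Nat.exists_eq_add_of_le hts
    rw [(h.reach M []).run_add, Config.run_halted, PMF.support_pure, Set.mem_singleton_iff] at hC
    rintro ⟨q, a, k, hk, -⟩
    simp [hC] at hk

theorem reach_call (h : Runs c S T k) (M : Oracle) :
    ∃ t ≤ k + 2, Reach M t ⟨[c.withCall d], S.mem⟩ ⟨[.call Reg.query Reg.answer, d], T.mem⟩ := by
  have reach_seq (c d : Prog) (p : List Prog) (μ : Memory) :
      Reach M 1 ⟨.seq c d :: p, μ⟩ ⟨c :: d :: p, μ⟩ :=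
    .step (by simp [Config.Calls]) (by simp only [Config.step]) (.refl _)
  obtain ⟨t, ht, h⟩ := h
  exact ⟨1 + (t + 1), by omega, (reach_seq _ _ _ _).trans ((h.reach M _).trans (reach_seq _ _ _ _))⟩

theorem run_call (M : Oracle) (t : ℕ) :
    Config.run M (t + 1) ⟨[.call Reg.query Reg.answer, d], T.mem⟩ = (M T.query).bind fun w =>
      Config.run M t ⟨[d], { T with query := [], answer := w }.mem⟩ := by
  simp only [Config.run, Config.step, PMF.bind_map, Function.comp_def, Store.update_mem]
  rfl

theorem eq_of_calls (hc : Runs c S T k)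
    (hd : ∀ w, Runs d { T with query := [], answer := w } (U w) l) {M : Oracle} {t : ℕ} {C : Config}
    (hC : C ∈ (Config.run M t ⟨[c.withCall d], S.mem⟩).support) {w : List ℝ} (hw : C.Calls w) :
    w = T.query := by
  obtain ⟨s, -, hreach⟩ := hc.reach_call (d := d) M
  rcases lt_or_ge t s with hts | hts
  · exact absurd hw (hreach.not_calls hts hC w)
  obtain ⟨r, rfl⟩ := Nat.exists_eq_add_of_le hts
  rw [hreach.run_add] at hC
  cases r with
  | zero =>
    obtain rfl : C = _ := by simpa [Config.run] using hC
    obtain ⟨q, a, p, h, rfl⟩ := hw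
    obtain ⟨⟨rfl, rfl⟩, -⟩ : (Reg.query = q ∧ Reg.answer = a) ∧ [d] = p := by simpa using h
    rfl
  | succ r =>
    rw [run_call, PMF.mem_support_bind_iff] at hC
    obtain ⟨v, -, hC⟩ := hC
    exact absurd hw ((hd v).not_calls hC w)

theorem run_withCall (hc : Runs c S T k)
    (hd : ∀ w, Runs d { T with query := [], answer := w } (U w) l) (M : Oracle) :
    Config.run M (k + l + 3) ⟨[c.withCall d], S.mem⟩ =
      (M T.query).map fun w => ⟨[], (U w).mem⟩ := by
  obtain ⟨s, hs, hreach⟩ := hc.reach_call (d := d) M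
  obtain ⟨r, hr⟩ := Nat.exists_eq_add_of_le (show s + (l + 1) ≤ k + l + 3 by omega)
  rw [hr, show s + (l + 1) + r = s + (l + r + 1) by omega, hreach.run_add, run_call]
  simp_rw [(hd _).run_eq M (Nat.le_add_right l r)]
  rfl

end Runs

/-! ### The reduction -/

theorem MaxProblem.isApproxSol_iff {P : MaxProblem} {x : P.Inst} [Finite (P.Sol x)] {α : ℝ}
    (hα : 1 ≤ α) {y : P.Sol x} :
    P.IsApproxSol x α y ↔ ∀ y', (P.measure x y' : ℝ) ≤ α * P.measure x y := by
  have hα₀ : 0 < α := zero_lt_one.trans_le hα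
  constructor
  · rintro ⟨opt, ⟨-, hmax⟩, -, hopt⟩ y'
    have hy' : P.measure x y' ≤ opt := hmax ⟨y', rfl⟩
    rcases eq_or_ne opt 0 with rfl | hne
    · rw [nonpos_iff_eq_zero.1 hy']
      positivity
    have hpos : (0 : ℝ) < opt := NNReal.coe_pos.2 (pos_iff_ne_zero.2 hne)
    have hratio := (hopt hne).1
    rw [div_le_div_iff₀ hα₀ hpos, one_mul, mul_comm] at hratio
    exact (NNReal.coe_le_coe.2 hy').trans hratio
  · intro h
    have : Nonempty (P.Sol x) := ⟨y⟩
    obtain ⟨z, hz⟩ := Finite.exists_max (P.measure x)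
    refine ⟨P.measure x z, ⟨⟨z, rfl⟩, Set.forall_mem_range.2 hz⟩,
      fun h₀ => nonpos_iff_eq_zero.1 (h₀ ▸ hz y), fun hne => ?_⟩
    have hpos : (0 : ℝ) < P.measure x z := NNReal.coe_pos.2 (pos_iff_ne_zero.2 hne)
    rw [div_le_div_iff₀ hα₀ hpos, one_mul, mul_comm, div_le_iff₀ hpos]
    exact ⟨h z, (NNReal.coe_le_coe.2 (hz y)).trans (le_mul_of_one_le_left hpos.le hα)⟩

namespace Reduction

open Constraint RawApplied

variable {f : Constraint} {G : List (Applied 5)} {F : Set Constraint} {m n : ℕ}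

/-- The applied constraint without the bound on its indices. -/
def RawApplied.ofApplied (a : Applied n) : RawApplied := ⟨a.con, fun k => a.scope k⟩

theorem prodEval_comp_val (H : List (Applied n)) (τ : ℕ → Bool) :
    prodEval H (τ ∘ Fin.val) = prodRaw (H.map ofApplied) τ := by
  simp only [prodEval, prodRaw, List.map_map]
  rfl

theorem enc_ofApplied (a : Applied n) : (ofApplied a).enc = a.enc := by
  simp only [RawApplied.enc, encNums, indices, values, List.map_map, List.map_ofFn, Applied.enc,
    List.bind_eq_flatMap, List.pure_def, ← List.map_eq_flatMap, Function.comp_def]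
  rfl

/-- The constraints of an instance. -/
def rawCons (x : CSPInstance F) : List RawApplied := x.cons.map ofApplied

theorem enc_eq (x : CSPInstance F) :
    x.enc = encList (.replicate x.n []) ++ encList ((rawCons x).map RawApplied.enc) := by
  simp only [CSPInstance.enc, rawCons, List.map_map, Function.comp_def, enc_ofApplied]

theorem scope_lt_of_mem_rawCons {x : CSPInstance F} {a : RawApplied} (ha : a ∈ rawCons x)
    (k : Fin a.con.arity) : a.scope k < x.n := by
  obtain ⟨b, -, rfl⟩ := List.mem_map.1 ha
  exact (b.scope k).2

theorem con_mem_of_mem_rawCons {x : CSPInstance F} {a : RawApplied} (ha : a ∈ rawCons x) :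
    a.con ∈ F := by
  obtain ⟨b, hb, rfl⟩ := List.mem_map.1 ha
  exact x.mem b hb

theorem bound_enc (x : CSPInstance F) : bound x.enc = bound (encAll (rawCons x)) := by
  have magnitude_zero : magnitude 0 = 1 := by simp [magnitude]
  simp [enc_eq, encList_replicate_nil, encList_map_enc, bound, magnitude_zero, magnitude_one]

/-- The instance that is passed to the oracle. -/
noncomputable def target (hG : IsGadget f G) (m : ℕ) (x : CSPInstance ({implies} ∪ F ∪ unary)) :
    CSPInstance ({f} ∪ F ∪ unary) where
  n := x.n + 3 * (rawCons x).length
  cons := (transform G m (rawCons x) x.n).pmap (fun b hb => ⟨b.con, fun k => ⟨b.scope k, hb k⟩⟩)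
    fun _ hb => scope_lt_of_mem_transform (fun _ => scope_lt_of_mem_rawCons) hb
  mem := by
    intro a ha
    obtain ⟨b, hb, rfl⟩ := List.mem_pmap.1 ha
    exact con_mem_of_mem_transform hG (fun _ => con_mem_of_mem_rawCons) hb

theorem rawCons_target (hG : IsGadget f G) (x : CSPInstance ({implies} ∪ F ∪ unary)) :
    rawCons (target hG m x) = transform G m (rawCons x) x.n := by
  rw [rawCons, target, List.map_pmap]
  exact (List.pmap_eq_map (p := fun _ => _) (f := id) _).trans (List.map_id _)

theorem isApproxSol_of_isApproxSol_target (hG : IsGadget f G)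
    {x : CSPInstance ({implies} ∪ F ∪ unary)}
    (hm : 2 * bound x.enc * (2 * bound x.enc) < 2 ^ m) {ε : ℝ} (hε : 0 < ε) (hε₁ : ε < 1)
    {τ : ℕ → Bool}
    (h : (MaxProdCSPStar ({f} ∪ F)).IsApproxSol (target hG m x) (2 ^ ε) (τ ∘ Fin.val)) :
    (MaxProdCSPStar ({implies} ∪ F)).IsApproxSol x (2 ^ ε) (τ ∘ Fin.val) := by
  have one_le_two_rpow : (1 : ℝ) ≤ 2 ^ ε := Real.one_le_rpow one_le_two hε.le
  have two_rpow_le_two : (2 : ℝ) ^ ε ≤ 2 := Real.rpow_le_self_of_one_le one_le_two hε₁.le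
  have : Finite ((MaxProdCSPStar ({implies} ∪ F)).Sol x) := Pi.finite
  have : Finite ((MaxProdCSPStar ({f} ∪ F)).Sol (target hG m x)) := Pi.finite
  have happrox := (MaxProblem.isApproxSol_iff one_le_two_rpow).1 h
  refine (MaxProblem.isApproxSol_iff one_le_two_rpow).2 fun ρ => ?_
  have measure_source (τ : ℕ → Bool) : (MaxProdCSPStar ({implies} ∪ F)).measure x (τ ∘ Fin.val) =
      prodRaw (rawCons x) τ := prodEval_comp_val _ _
  have measure_target (τ : ℕ → Bool) : (MaxProdCSPStar ({f} ∪ F)).measure (target hG m x)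
      (τ ∘ Fin.val) = prodRaw (transform G m (rawCons x) x.n) τ :=
    (prodEval_comp_val _ _).trans (congrArg (prodRaw · τ) (rawCons_target hG x))
  obtain ⟨τ₀, rfl⟩ := Fin.val_injective.surjective_comp_right ρ
  change ((MaxProdCSPStar ({implies} ∪ F)).measure x (τ₀ ∘ Fin.val) : ℝ) ≤ _
  rw [measure_source, measure_source]
  rcases eq_or_ne (prodRaw (rawCons x) τ₀) 0 with h₀ | h₀
  · rw [h₀]
    positivity
  obtain ⟨τ₁, -, hτ₁⟩ := exists_prodRaw_transform hG (m := m)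
    (fun _ => scope_lt_of_mem_rawCons) fun _ => not_violated_of_prodRaw_ne_zero h₀
  replace happrox := happrox (τ₁ ∘ Fin.val)
  rw [measure_target, measure_target, hτ₁] at happrox
  refine happrox.trans (mul_le_mul_of_nonneg_left ?_ (by positivity))
  rw [bound_enc] at hm
  refine NNReal.coe_le_coe.2 (prodRaw_transform_le_prodRaw hG hm h₀ ?_)
  exact_mod_cast happrox.trans (mul_le_mul_of_nonneg_right two_rpow_le_two (NNReal.coe_nonneg _))

theorem ofFn_getD_mem_goodOutputs (hG : IsGadget f G) {x : CSPInstance ({implies} ∪ F ∪ unary)}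
    (hm : 2 * bound x.enc * (2 * bound x.enc) < 2 ^ m) {ε : ℝ} (hε : 0 < ε) (hε₁ : ε < 1)
    {w : List ℝ} (hw : w ∈ (MaxProdCSPStar ({f} ∪ F)).goodOutputs (target hG m x) ε) :
    (List.ofFn fun i : Fin x.n => w.getD i 0) ∈
      (MaxProdCSPStar ({implies} ∪ F)).goodOutputs x ε := by
  obtain ⟨σ, rfl, hσ⟩ := hw
  obtain ⟨τ, rfl⟩ := Fin.val_injective.surjective_comp_right σ
  refine ⟨τ ∘ Fin.val, congrArg List.ofFn (funext fun i => ?_),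
    isApproxSol_of_isApproxSol_target hG hm hε hε₁ hσ⟩
  change (List.ofFn fun j : Fin (target hG m x).n => encBit (τ j)).getD i 0 = encBit (τ i)
  have hi : (i : ℕ) < (target hG m x).n := i.2.trans_le (Nat.le_add_right _ _)
  rw [List.getD_eq_getElem _ _ (by simpa using hi), List.getElem_ofFn]

theorem exists_two_pow_le_iff_lt {b : ℝ} (hb : 1 ≤ b) : ∃ m : ℕ, ∀ k, (2 : ℝ) ^ k ≤ b ↔ k < m := by
  obtain ⟨n, hn, hn'⟩ := exists_nat_pow_near hb one_lt_two
  refine ⟨n + 1, fun k => ⟨fun hk => ?_, fun hk => ?_⟩⟩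
  · exact (pow_lt_pow_iff_right₀ one_lt_two).1 (hk.trans_lt hn')
  · exact (pow_le_pow_right₀ one_le_two (Nat.le_of_lt_succ hk)).trans hn

/-- The number of steps of the reduction on the encoding `w` of an instance with `n` variables,
where `m` copies of the gadget replace every constraint `Implies`. -/
def runningTime (G : List (Applied 5)) (m n : ℕ) (w : List ℝ) : ℕ :=
  w.length * (m * (2 * (symbolsAll G).length + 10) + 300) + (12 * n + 3) + 3

theorem le_wordSize_of_two_pow_le_iff_lt {w : List ℝ}
    (hm : ∀ k, (2 : ℝ) ^ k ≤ 2 * bound w * (2 * bound w) ↔ k < m) :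
    (m : ℝ) ≤ 2 * wordSize w + 3 := by
  rcases m with - | m
  · have := (Nat.cast_nonneg _).trans (length_le_wordSize w)
    push_cast
    linarith
  have hB := bound_le_rpow_wordSize w
  have hpow : (2 : ℝ) ^ (m : ℝ) ≤ 2 ^ (1 + wordSize w + (1 + wordSize w)) := by
    rw [Real.rpow_natCast, Real.rpow_add two_pos, Real.rpow_add two_pos, Real.rpow_one]
    refine ((hm m).2 m.lt_succ_self).trans ?_
    gcongr
  have := (Real.rpow_le_rpow_left_iff one_lt_two).1 hpow
  push_cast
  linarith

theorem runningTime_le (x : CSPInstance F) (hm : (m : ℝ) ≤ 2 * wordSize x.enc + 3) :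
    (runningTime G m x.n x.enc : ℝ) ≤ wordSize x.enc *
      ((2 * wordSize x.enc + 3) * ((2 * (symbolsAll G).length + 10 : ℕ) : ℝ) + 312) + 6 := by
  have hlen := length_le_wordSize x.enc
  have hn : (x.n : ℝ) ≤ wordSize x.enc := by
    refine le_trans (Nat.cast_le.2 ?_) hlen
    rw [enc_eq, encList_replicate_nil]
    simp
  have h₀ : 0 ≤ wordSize x.enc := (Nat.cast_nonneg _).trans hlen
  have hloop : (x.enc.length : ℝ) * (m * (2 * (symbolsAll G).length + 10 : ℕ) + 300) ≤
      wordSize x.enc * ((2 * wordSize x.enc + 3) * (2 * (symbolsAll G).length + 10 : ℕ) + 300) := by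
    gcongr
  simp only [runningTime, Nat.cast_add, Nat.cast_mul, Nat.cast_ofNat] at hloop ⊢
  linarith

theorem run_program (hG : IsGadget f G) (x : CSPInstance ({implies} ∪ F ∪ unary)) (ε : ℝ)
    (hm : ∀ k, (2 : ℝ) ^ k ≤ 2 * bound x.enc * (2 * bound x.enc) ↔ k < m) (M : Oracle) :
    (∀ t, ∀ C ∈ (Config.run M t (Config.start (program G) (ε :: x.enc))).support, ∀ w, C.Calls w →
      w = ε :: (target hG m x).enc) ∧
    ∃ U : List ℝ → Store, (∀ w, (U w).output = List.ofFn fun i : Fin x.n => w.getD i 0) ∧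
      Config.run M (runningTime G m x.n x.enc) (Config.start (program G) (ε :: x.enc)) =
        (M (ε :: (target hG m x).enc)).map fun w => ⟨[], (U w).mem⟩ := by
  have hprepare := runs_prepareQuery (G := G) (ε := ε) (enc_eq x) hm
  rw [← rawCons_target hG x] at hprepare
  have hanswer (w : List ℝ) := runs_restrictAnswer w
    { state ε (2 * bound x.enc * (2 * bound x.enc)) x.n (x.n + 3 * (rawCons x).length) [0] [] with
      newVars := [] } x.n
  rw [Store.start_mem, enc_eq (target hG m x)]
  exact ⟨fun t C hC w hw => hprepare.eq_of_calls hanswer hC hw, _, fun w => rfl,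
    hprepare.run_withCall hanswer M⟩

theorem aptReduces_of_isGadget (hG : IsGadget f G) (F : Set Constraint) :
    APTReduces (MaxProdCSPStar ({implies} ∪ F)) (MaxProdCSPStar ({f} ∪ F)) := by
  refine ⟨program G, MvPolynomial.X 1, MvPolynomial.X 0 * ((2 * MvPolynomial.X 0 + 3) *
    MvPolynomial.C ((2 * (symbolsAll G).length + 10 : ℕ) : ℝ) + 312) + 6,
    fun M hM x ε hε hε₁ => ?_⟩
  change CSPInstance ({implies} ∪ F ∪ unary) at x
  change (∀ t, ∀ C ∈ (Config.run M t (Config.start (program G) (ε :: x.enc))).support, _) ∧ _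
  have hB : (1 : ℝ) ≤ bound x.enc := one_le_bound x.enc
  obtain ⟨m, hm⟩ := exists_two_pow_le_iff_lt
    (show 1 ≤ 2 * (bound x.enc : ℝ) * (2 * bound x.enc) by nlinarith)
  obtain ⟨hcalls, U, hU, hrun⟩ := run_program hG x ε hm M
  refine ⟨fun t C hC w hw => ⟨target hG m x, ε, hcalls t C hC w hw, hε, hε₁, by simp⟩,
    runningTime G m x.n x.enc, ?_, ?_, ?_⟩
  · have hle := runningTime_le (G := G) x (le_wordSize_of_two_pow_le_iff_lt hm)
    simp only [map_add, map_mul, MvPolynomial.eval_X, MvPolynomial.eval_C, map_ofNat,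
      Matrix.cons_val_zero]
    exact hle
  · intro C hC
    change C ∈ (Config.run M _ (Config.start (program G) (ε :: x.enc))).support at hC
    rw [hrun, PMF.mem_support_map_iff] at hC
    obtain ⟨w, -, rfl⟩ := hC
    rfl
  · change _ ≤ ((Config.run M _ (Config.start (program G) (ε :: x.enc))).map _).toOuterMeasure _
    rw [hrun, PMF.map_comp, PMF.toOuterMeasure_map_apply]
    refine (hM (target hG m x) ε hε hε₁).trans (MeasureTheory.measure_mono fun w hw => ?_)
    have hm' : 2 * bound x.enc * (2 * bound x.enc) < 2 ^ m := by
      exact_mod_cast not_le.1 fun h => lt_irrefl m ((hm m).1 h)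
    change (U w).output ∈ (MaxProdCSPStar ({implies} ∪ F)).goodOutputs x ε
    rw [hU]
    exact ofFn_getD_mem_goodOutputs hG hm' hε hε₁ hw

end Reduction

theorem mainTheorem4 (f : Constraint) (hf : f.HasImpSupport)
    (h : ¬ f.HasAffineSupport ∨ f ∉ Constraint.ED) (F : Set Constraint) :
    APTReduces (MaxProdCSPStar ({Constraint.implies} ∪ F)) (MaxProdCSPStar ({f} ∪ F)) := by
  obtain ⟨G, hG⟩ := hf.exists_isGadget h
  exact Reduction.aptReduces_of_isGadget hG F
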